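/- Let $\mathcal H$ be the set of twice differentiable functions $\varphi:\mathbb R\to\mathbb R$ with $\|\varphi'\|_\infty\le 1$ and $\|\varphi''\|_\infty\le 1$, and for probability measures $\mathbf P,\mathbf Q$ on $\mathbb R$ let $$\kappa_{\mathcal H}(\mathbf P,\mathbf Q)=\sup_{\varphi\in\mathcal H}\Big|\int\varphi\,d\mathbf P-\int\varphi\,d\mathbf Q\Big|.$$ For $r,\lambda>0$ let $\bar Y_{r,\lambda}=Y_{r,\lambda}-r/\lambda$, where $Y_{r,\lambda}$ has the Gamma distribution with density $\frac{\lambda^r}{\Gamma(r)}x^{r-1}e^{-\lambda x}\mathbf 1_{x>0}$. Write $\mathbf P_Z$ for the law of $Z$. **(1) Quadratic forms.** For every $\nu>0$ there is a constant $c_\nu>0$, depending only on $\nu$, such that the following holds. Let $n\ge 1$, $A=\{1,\dots,n\}$, let $X_1,\dots,X_n$ be independent real random variables with $\mathbf E[X_i]=0$, $\operatorname{var}(X_i)=1$ and $\mathbf E[X_i^4]<\infty$, and let $f:A^2\to\mathbb R$ be symmetric, vanishing on the diagonal, with $\sum_{(i,j)\in A^2}f^2(i,j)=\nu$. Put $$F=\sum_{(i,j)\in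 A^2,\ i\ne j}f(i,j)X_iX_j,\qquad (f\star_1^1 f)(i,j)=\sum_{k\in A}f(i,k)f(j,k),\qquad (f\star_2^1 f)(i)=\sum_{j\in A}f(i,j)^2 .$$ Then $$\kappa_{\mathcal H}^2\big(\mathbf P_F,\mathbf P_{\bar Y_{\nu/2,1/2}}\big)\le c_\nu\,\Big(\max_{i\in A}\mathbf E[X_i^4]\Big)^2\Big[\sum_{(i,j)\in A^2}f^4(i,j)+\sum_{i\in A}(f\star_2^1 f)(i)^2+\sum_{(i,j)\in A^2}\big(f(i,j)-(f\star_1^1 f)(i,j)\big)^2\Big].$$ In particular, when the $X_i$ are identically distributed, the factor $\max_i\mathbf E[X_i^4]$ is $\mathbf E[X_1^4]$. **(2) Degenerate U-statistics of order 2.** For every $\sigma>0$ there is a constant $c>0$, depending only on $\sigma$ (in particular not on $n$), such that for every $n\ge 2$ and all independent, identically distributed real random variables $X_1,\dots,X_n$ with $\mathbf E[X_1]=0$, $\mathbf E[X_1^2]=\sigma^2$ and $\mathbf E[X_1^4]<\infty$, the random variable $$F=\frac{2}{n-1}\sum_{1\le i<j\le n}X_iX_j$$ satisfies $$\kappa_{\mathcal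 H}\big(\mathbf P_F,\mathbf P_{\bar Y_{1/2,\,1/(2\sigma^2)}}\big)\le c\,\frac{\sigma^2}{\sqrt n}\,\mathbf E[X_1^4].$$ -/

import Mathlib

open MeasureTheory ProbabilityTheory

noncomputable section

/-- The test functions: twice differentiable functions on the real line whose first and second
derivatives are bounded by `1`. -/
def testClass : Set (ℝ → ℝ) :=
  {φ | Differentiable ℝ φ ∧ Differentiable ℝ (deriv φ) ∧
    (∀ x, |deriv φ x| ≤ 1) ∧ ∀ x, |deriv (deriv φ) x| ≤ 1}

/-- The distance between two measures on the real line generated by a class `H` of test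
functions: the supremum over `φ ∈ H` of `|∫ φ dP - ∫ φ dQ|`, with values in `[0, ∞]`. -/
def kappa (H : Set (ℝ → ℝ)) (P Q : Measure ℝ) : ENNReal :=
  ⨆ φ ∈ H, ENNReal.ofReal |∫ x, φ x ∂P - ∫ x, φ x ∂Q|

/-- The law of `Y - r / l`, where `Y` has the Gamma distribution with shape `r` and rate `l`
(so that `r / l` is the mean of `Y`). -/
def centeredGamma (r l : ℝ) : Measure ℝ :=
  (gammaMeasure r l).map (fun y => y - r / l)

/-- The contraction `(f ⋆₁¹ g)(i, j) = ∑ k, f(i, k) g(j, k)`. -/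
def contr11 {n : ℕ} (f g : Fin n → Fin n → ℝ) (i j : Fin n) : ℝ :=
  ∑ k, f i k * g j k

/-- The contraction `(f ⋆₂¹ g)(i) = ∑ j, f(i, j) g(i, j)`. -/
def contr21 {n : ℕ} (f g : Fin n → Fin n → ℝ) (i : Fin n) : ℝ :=
  ∑ j, f i j * g i j

/-- The homogeneous sum of order two: the sum of `f(i, j) X_i X_j` over all ordered couples
`(i, j)` with distinct components. -/
def quadForm {n : ℕ} {Ω : Type*} (f : Fin n → Fin n → ℝ) (X : Fin n → Ω → ℝ) (ω : Ω) : ℝ :=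
  ∑ p ∈ (Finset.univ : Finset (Fin n)).offDiag, f p.1 p.2 * X p.1 ω * X p.2 ω

/-- The normalized degenerate `U`-statistic of order two:
`2 / (n - 1)` times the sum of `X_i X_j` over `i < j`. -/
def uStat {n : ℕ} {Ω : Type*} (X : Fin n → Ω → ℝ) (ω : Ω) : ℝ :=
  2 / ((n : ℝ) - 1) * ∑ i : Fin n, ∑ j ∈ Finset.Ioi i, X i ω * X j ω

end

/-! Read `f` as a symmetric matrix. If `f` is close to `f²` in Hilbert-Schmidt norm, rounding its
eigenvalues to 0 or 1 gives an orthogonal projection `p` with `‖p - f‖² ≤ 4 ‖f - f²‖²`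
(`exists_isProjKernel_near`). For a Gaussian vector the form of `p` is a chi-square variable of `tr
p` degrees of freedom, that is, a Gamma variable (`IsProjKernel.map_kernelForm_gaussianPi`). So it
suffices to replace `f` by the centered form of `p`, and then the variables by Gaussian ones.

The first replacement costs a constant times `√M ‖p - f‖`, by a second moment computation
(`integral_centered_form_sq_le`). The second costs a constant times `M ∑ p_ii^(3/2)`
(`abs_integral_kernelForm_sub_gaussian_le`), hence at most a constant times `M √(tr p) (∑
p_ii²)^(1/2)`. Since `f` has zero diagonal, `∑ p_ii² ≤ ‖p - f‖²`, so a single quantity controls both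
errors.

The Gaussian replacement interpolates along `sin θ • x + cos θ • y`. Integration by parts in `y`
turns each term of the derivative into a Stein discrepancy of one coordinate of `x`, of third order
in the smoothed function. The test functions control only two derivatives. The third is traded for
the Gaussian smoothing: because `p² = p`, the third-order quantity is itself a Gaussian integration
by parts of the second-order one (`integral_kernelCoord_mul_formHess`). The price `1 / cos θ` is
cancelled by the factor `cos θ` of the interpolation. The estimate therefore does not see the bound
on the third derivative, and Steklov means extend it to the whole test class.

The rank of `p` is an integer and may differ from `ν`. Then `‖f - f²‖` is bounded below in terms of
`ν`, and a crude first moment bound suffices. The term `‖f - f²‖²` alone carries the estimate for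
quadratic forms; the other two sums in the bracket are nonnegative and are simply added. For the
U-statistic, `p` is the projection onto constant vectors. -/

/-! ### Product measures and resampling of one coordinate. -/

/-- Resampling one coordinate preserves a product measure. -/
theorem measurePreserving_update_pi {ι : Type*} [Fintype ι] [DecidableEq ι]
    (μ : ι → Measure ℝ) [∀ i, IsProbabilityMeasure (μ i)] (i : ι) :
    MeasurePreserving (fun p : (ι → ℝ) × ℝ => Function.update p.1 i p.2)
      ((Measure.pi μ).prod (μ i)) (Measure.pi μ) := by
  have hm : Measurable (fun p : (ι → ℝ) × ℝ => Function.update p.1 i p.2) := by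
    rw [measurable_pi_iff]
    intro j
    by_cases hj : j = i
    · subst hj; simpa using measurable_snd
    · simp only [Function.update_of_ne hj]
      fun_prop
  refine ⟨hm, ?_⟩
  symm
  refine Measure.pi_eq fun s hs => ?_
  rw [Measure.map_apply hm (MeasurableSet.univ_pi hs)]
  have : (fun p : (ι → ℝ) × ℝ => Function.update p.1 i p.2) ⁻¹' (Set.univ.pi s) =
      (Set.univ.pi (Function.update s i Set.univ)) ×ˢ s i := by
    ext p
    simp only [Set.mem_preimage, Set.mem_pi, Set.mem_univ, forall_const, Set.mem_prod]
    constructor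
    · intro h
      refine ⟨fun j => ?_, by simpa using h i⟩
      by_cases hj : j = i
      · subst hj; simp
      · simpa [Function.update_of_ne hj] using h j
    · rintro ⟨h1, h2⟩ j
      by_cases hj : j = i
      · subst hj; simpa using h2
      · simpa [Function.update_of_ne hj] using h1 j
  rw [this, Measure.prod_prod, Measure.pi_pi, ← Finset.mul_prod_erase _ _ (Finset.mem_univ i),
    ← Finset.mul_prod_erase _ (fun j => μ j (s j)) (Finset.mem_univ i)]
  simp only [Function.update_self, measure_univ, one_mul]
  rw [mul_comm]
  congr 1
  refine Finset.prod_congr rfl fun j hj => ?_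
  rw [Function.update_of_ne (Finset.ne_of_mem_erase hj)]

theorem integrable_update_pi {ι : Type*} [Fintype ι] [DecidableEq ι]
    (μ : ι → Measure ℝ) [∀ i, IsProbabilityMeasure (μ i)] (i : ι) {F : (ι → ℝ) → ℝ}
    (hF : Integrable F (Measure.pi μ)) :
    Integrable (fun p : (ι → ℝ) × ℝ => F (Function.update p.1 i p.2))
      ((Measure.pi μ).prod (μ i)) :=
  (measurePreserving_update_pi μ i).integrable_comp_of_integrable hF

/-- Fubini in one coordinate, written with `Function.update` so that the index type need not be
split. -/
theorem integral_pi_eq_integral_update {ι : Type*} [Fintype ι] [DecidableEq ι]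
    (μ : ι → Measure ℝ) [∀ i, IsProbabilityMeasure (μ i)] (i : ι) {F : (ι → ℝ) → ℝ}
    (hF : Integrable F (Measure.pi μ)) :
    ∫ x, F x ∂Measure.pi μ = ∫ x, ∫ a, F (Function.update x i a) ∂μ i ∂Measure.pi μ := by
  have h := measurePreserving_update_pi μ i
  have h2 := integrable_update_pi μ i hF
  rw [← integral_prod _ h2]
  conv_lhs => rw [← h.map_eq]
  rw [integral_map h.measurable.aemeasurable]
  rw [h.map_eq]; exact hF.aestronglyMeasurable

/-! ### Gaussian integration by parts for functions of polynomial growth. -/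

/-- Integration by parts for the standard normal law. -/
theorem integral_id_mul_gaussianReal {F F' : ℝ → ℝ} (hd : ∀ x, HasDerivAt F (F' x) x)
    (hF : Integrable F (gaussianReal 0 1)) (hxF : Integrable (fun x => x * F x) (gaussianReal 0 1))
    (hF' : Integrable F' (gaussianReal 0 1)) :
    ∫ x, x * F x ∂gaussianReal 0 1 = ∫ x, F' x ∂gaussianReal 0 1 := by
  have key : ∀ {G : ℝ → ℝ}, Integrable G (gaussianReal 0 1) →
      Integrable (fun x => G x * gaussianPDFReal 0 1 x) := by
    intro G hG
    rw [gaussianReal_of_var_ne_zero _ one_ne_zero] at hG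
    have := (integrable_withDensity_iff (measurable_gaussianPDF 0 1)
      (Filter.Eventually.of_forall fun x => gaussianPDF_lt_top)).1 hG
    simpa using this
  have hp : ∀ x, HasDerivAt (gaussianPDFReal 0 1) (-(x * gaussianPDFReal 0 1 x)) x := by
    intro x
    have h1 : HasDerivAt (fun x : ℝ => -(x - 0) ^ 2 / (2 * ((1 : NNReal) : ℝ))) (-x) x := by
      have := (((hasDerivAt_id x).sub_const 0).pow 2).neg.div_const (2 * ((1 : NNReal) : ℝ))
      refine this.congr_deriv ?_
      simp; ring
    have h2 := (h1.exp).const_mul ((√(2 * Real.pi * ((1 : NNReal) : ℝ)))⁻¹)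
    have h3 : gaussianPDFReal 0 1 = fun x : ℝ => (√(2 * Real.pi * ((1 : NNReal) : ℝ)))⁻¹ *
        Real.exp (-(x - 0) ^ 2 / (2 * ((1 : NNReal) : ℝ))) := rfl
    rw [h3]
    refine h2.congr_deriv ?_
    ring
  have := integral_mul_deriv_eq_deriv_mul_of_integrable (u := F) (v := gaussianPDFReal 0 1)
    (u' := F') (v' := fun x => -(x * gaussianPDFReal 0 1 x)) (fun x _ => hd x) (fun x _ => hp x) ?_ ?_ ?_
  · rw [integral_gaussianReal_eq_integral_smul one_ne_zero,
      integral_gaussianReal_eq_integral_smul one_ne_zero]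
    simp only [smul_eq_mul]
    have e1 : ∫ x, gaussianPDFReal 0 1 x * (x * F x) =
        -∫ x, F x * -(x * gaussianPDFReal 0 1 x) := by
      rw [← integral_neg]; congr 1; ext x; ring
    rw [e1, this, neg_neg]
    congr 1; ext x; ring
  · refine (key hxF).neg.congr (Filter.Eventually.of_forall fun x => ?_)
    simp; ring
  · exact key hF'
  · exact key hF

/-- Measurable functions of at most polynomial growth. -/
def PolyGrowth {E : Type*} [NormedAddCommGroup E] [MeasurableSpace E] (G : E → ℝ) : Prop :=
  Measurable G ∧ ∃ C : ℝ, ∃ k : ℕ, ∀ y, |G y| ≤ C * (1 + ‖y‖) ^ k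

namespace PolyGrowth
variable {E : Type*} [NormedAddCommGroup E] [MeasurableSpace E] {F G : E → ℝ}

theorem exists_nonneg (h : PolyGrowth F) :
    ∃ C : ℝ, 0 ≤ C ∧ ∃ k : ℕ, ∀ y, |F y| ≤ C * (1 + ‖y‖) ^ k := by
  obtain ⟨-, C, k, h⟩ := h
  refine ⟨|C|, abs_nonneg _, k, fun y => (h y).trans ?_⟩
  gcongr
  exact le_abs_self C

theorem mul (hF : PolyGrowth F) (hG : PolyGrowth G) : PolyGrowth fun y => F y * G y := by
  obtain ⟨C, hC, k, h⟩ := hF.exists_nonneg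
  obtain ⟨C', hC', k', h'⟩ := hG.exists_nonneg
  refine ⟨hF.1.mul hG.1, C * C', k + k', fun y => ?_⟩
  rw [abs_mul, pow_add]
  calc |F y| * |G y| ≤ (C * (1 + ‖y‖) ^ k) * (C' * (1 + ‖y‖) ^ k') := by
        gcongr
        · exact h y
        · exact h' y
    _ = _ := by ring

theorem add (hF : PolyGrowth F) (hG : PolyGrowth G) : PolyGrowth fun y => F y + G y := by
  obtain ⟨C, hC, k, h⟩ := hF.exists_nonneg
  obtain ⟨C', hC', k', h'⟩ := hG.exists_nonneg
  refine ⟨hF.1.add hG.1, C + C', max k k', fun y => ?_⟩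
  have h1 : (1 : ℝ) ≤ 1 + ‖y‖ := by linarith [norm_nonneg y]
  calc |F y + G y| ≤ |F y| + |G y| := abs_add_le _ _
    _ ≤ C * (1 + ‖y‖) ^ k + C' * (1 + ‖y‖) ^ k' := add_le_add (h y) (h' y)
    _ ≤ C * (1 + ‖y‖) ^ max k k' + C' * (1 + ‖y‖) ^ max k k' := by
        gcongr <;> first | exact h1 | simp
    _ = _ := by ring

theorem of_bounded (hF : Measurable F) {C : ℝ} (h : ∀ y, |F y| ≤ C) : PolyGrowth F :=
  ⟨hF, C, 0, fun y => by simpa using h y⟩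

theorem const (c : ℝ) : PolyGrowth fun _ : E => c := of_bounded measurable_const fun _ => le_rfl

theorem const_mul (c : ℝ) (hF : PolyGrowth F) : PolyGrowth fun y => c * F y := (const c).mul hF

theorem pow (hF : PolyGrowth F) (n : ℕ) : PolyGrowth fun y => F y ^ n := by
  induction n with
  | zero => simpa using const (E := E) 1
  | succ n ih => simpa [pow_succ] using ih.mul hF

theorem abs (hF : PolyGrowth F) : PolyGrowth fun y => |F y| := by
  obtain ⟨hm, C, k, h⟩ := hF
  exact ⟨hm.abs, C, k, fun y => by simpa using h y⟩

theorem sum {α : Type*} (s : Finset α) {F : α → E → ℝ} (h : ∀ i, PolyGrowth (F i)) :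
    PolyGrowth fun y => ∑ i ∈ s, F i y := by
  classical
  induction s using Finset.induction_on with
  | empty => simpa using const (E := E) 0
  | insert a s ha ih => simpa [Finset.sum_insert ha] using (h a).add ih

theorem eval {ι : Type*} [Fintype ι] (i : ι) : PolyGrowth fun y : ι → ℝ => y i :=
  ⟨measurable_pi_apply i, 1, 1, fun y => by
    have := norm_le_pi_norm y i
    rw [Real.norm_eq_abs] at this
    simp; linarith⟩

theorem id_real : PolyGrowth fun y : ℝ => y :=
  ⟨measurable_id, 1, 1, fun y => by simp⟩

theorem update {ι : Type*} [Fintype ι] [DecidableEq ι] {G : (ι → ℝ) → ℝ} (hG : PolyGrowth G)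
    (y : ι → ℝ) (j : ι) : PolyGrowth fun a : ℝ => G (Function.update y j a) := by
  obtain ⟨C, hC, k, h⟩ := hG.exists_nonneg
  refine ⟨hG.1.comp (measurable_update y), C * (1 + ‖y‖) ^ k, k, fun a => (h _).trans ?_⟩
  rw [mul_assoc, ← mul_pow]
  have : ‖Function.update y j a‖ ≤ ‖y‖ + ‖a‖ := by
    rw [pi_norm_le_iff_of_nonneg (by positivity)]
    intro i
    by_cases hi : i = j
    · subst hi; simp
    · rw [Function.update_of_ne hi]
      linarith [norm_le_pi_norm y i, norm_nonneg a]
  gcongr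
  nlinarith [norm_nonneg y, norm_nonneg a, mul_nonneg (norm_nonneg y) (norm_nonneg a)]

theorem integrable_of_memLp {μ : Measure E} [IsProbabilityMeasure μ]
    (hμ : ∀ k : ℕ, MemLp (fun y => ‖y‖) k μ) (hG : PolyGrowth G) : Integrable G μ := by
  obtain ⟨C, hC, k, h⟩ := hG.exists_nonneg
  have h1 : MemLp (fun y : E => 1 + ‖y‖) k μ := (memLp_const (1 : ℝ)).add (hμ k)
  have h2 : Integrable (fun y : E => ‖1 + ‖y‖‖ ^ k) μ := h1.integrable_norm_pow'
  refine Integrable.mono' (h2.const_mul C) hG.1.aestronglyMeasurable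
    (Filter.Eventually.of_forall fun y => ?_)
  rw [Real.norm_eq_abs, Real.norm_eq_abs, abs_of_nonneg (by positivity : 0 ≤ 1 + ‖y‖)]
  exact h y

theorem integrable_gaussianReal {G : ℝ → ℝ} (hG : PolyGrowth G) :
    Integrable G (gaussianReal 0 1) :=
  hG.integrable_of_memLp fun k => (memLp_id_gaussianReal' k (by simp)).norm

theorem integrable_pi_gaussianReal {ι : Type*} [Fintype ι] {G : (ι → ℝ) → ℝ} (hG : PolyGrowth G) :
    Integrable G (Measure.pi fun _ : ι => gaussianReal 0 1) := by
  refine hG.integrable_of_memLp fun k => ?_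
  have h1 : ∀ i : ι, MemLp (fun y : ι → ℝ => y i) k (Measure.pi fun _ : ι => gaussianReal 0 1) :=
    fun i => (memLp_id_gaussianReal' k (by simp)).comp_measurePreserving
      (measurePreserving_eval (fun _ : ι => gaussianReal 0 1) i)
  have h2 : MemLp (fun y : ι → ℝ => ∑ i, ‖y i‖) k (Measure.pi fun _ : ι => gaussianReal 0 1) :=
    memLp_finsetSum _ fun i _ => (h1 i).norm
  refine h2.mono (by fun_prop) (Filter.Eventually.of_forall fun y => ?_)
  rw [norm_norm, Real.norm_of_nonneg (Finset.sum_nonneg fun i _ => norm_nonneg _),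
    pi_norm_le_iff_of_nonneg (Finset.sum_nonneg fun i _ => norm_nonneg _)]
  exact fun i => Finset.single_le_sum (f := fun i => ‖y i‖) (fun i _ => norm_nonneg _)
    (Finset.mem_univ i)

end PolyGrowth

/-- Gaussian integration by parts in one coordinate of a standard Gaussian vector. -/
theorem integral_eval_mul_pi_gaussianReal {ι : Type*} [Fintype ι] [DecidableEq ι] (j : ι)
    {G G' : (ι → ℝ) → ℝ} (hG : PolyGrowth G) (hG' : PolyGrowth G')
    (hd : ∀ y a, HasDerivAt (fun a => G (Function.update y j a)) (G' (Function.update y j a)) a) :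
    ∫ y, y j * G y ∂(Measure.pi fun _ : ι => gaussianReal 0 1) =
      ∫ y, G' y ∂(Measure.pi fun _ : ι => gaussianReal 0 1) := by
  rw [integral_pi_eq_integral_update (fun _ : ι => gaussianReal 0 1) j
      ((PolyGrowth.eval j).mul hG).integrable_pi_gaussianReal,
    integral_pi_eq_integral_update (fun _ : ι => gaussianReal 0 1) j
      hG'.integrable_pi_gaussianReal]
  congr 1
  ext y
  simp only [Function.update_self]
  exact integral_id_mul_gaussianReal (fun a => hd y a) (hG.update y j).integrable_gaussianReal
    (PolyGrowth.id_real.mul (hG.update y j)).integrable_gaussianReal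
    (hG'.update y j).integrable_gaussianReal

/-! ### Quadratic forms of projections and derivatives of test functions along them. -/

/-- The entries of the matrix of an orthogonal projection. -/
structure IsProjKernel {ι : Type*} [Fintype ι] (p : ι → ι → ℝ) : Prop where
  symm : ∀ i j, p i j = p j i
  idem : ∀ i k, ∑ j, p i j * p j k = p i k

/-- The `i`-th coordinate of the product of the matrix `p` and the vector `z`. -/
def kernelCoord {ι : Type*} [Fintype ι] (p : ι → ι → ℝ) (i : ι) (z : ι → ℝ) : ℝ :=
  ∑ j, p i j * z j

/-- The quadratic form of the matrix `p`. -/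
def kernelForm {ι : Type*} [Fintype ι] (p : ι → ι → ℝ) (z : ι → ℝ) : ℝ :=
  ∑ i, z i * kernelCoord p i z

/-- A three times differentiable function with the first two derivatives bounded by `1` and the
third one bounded by `B`. -/
structure IsSmoothTest (h h₁ h₂ h₃ : ℝ → ℝ) (B : ℝ) : Prop where
  deriv₁ : ∀ x, HasDerivAt h (h₁ x) x
  deriv₂ : ∀ x, HasDerivAt h₁ (h₂ x) x
  deriv₃ : ∀ x, HasDerivAt h₂ (h₃ x) x
  bound₁ : ∀ x, |h₁ x| ≤ 1
  bound₂ : ∀ x, |h₂ x| ≤ 1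
  bound₃ : ∀ x, |h₃ x| ≤ B

namespace IsSmoothTest
variable {h h₁ h₂ h₃ : ℝ → ℝ} {B : ℝ}

theorem measurable₀ (H : IsSmoothTest h h₁ h₂ h₃ B) : Measurable h :=
  (continuous_iff_continuousAt.2 fun x => (H.deriv₁ x).continuousAt).measurable

theorem measurable₁ (H : IsSmoothTest h h₁ h₂ h₃ B) : Measurable h₁ :=
  (continuous_iff_continuousAt.2 fun x => (H.deriv₂ x).continuousAt).measurable

theorem measurable₂ (H : IsSmoothTest h h₁ h₂ h₃ B) : Measurable h₂ :=
  (continuous_iff_continuousAt.2 fun x => (H.deriv₃ x).continuousAt).measurable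

theorem measurable₃ (H : IsSmoothTest h h₁ h₂ h₃ B) : Measurable h₃ := by
  have : h₃ = deriv h₂ := funext fun x => (H.deriv₃ x).deriv.symm
  rw [this]
  exact measurable_deriv _

theorem nonneg (H : IsSmoothTest h h₁ h₂ h₃ B) : 0 ≤ B := (abs_nonneg _).trans (H.bound₃ 0)

end IsSmoothTest

section kernel
variable {ι : Type*} [Fintype ι] {p : ι → ι → ℝ}

theorem kernelCoord_add (i : ι) (x y : ι → ℝ) :
    kernelCoord p i (x + y) = kernelCoord p i x + kernelCoord p i y := by
  simp [kernelCoord, mul_add, Finset.sum_add_distrib]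

theorem kernelCoord_smul (i : ι) (c : ℝ) (x : ι → ℝ) :
    kernelCoord p i (c • x) = c * kernelCoord p i x := by
  simp only [kernelCoord, Pi.smul_apply, smul_eq_mul, Finset.mul_sum]
  exact Finset.sum_congr rfl fun j _ => by ring

theorem kernelCoord_single [DecidableEq ι] (i j : ι) (c : ℝ) :
    kernelCoord p i (Pi.single j c) = c * p i j := by
  simp [kernelCoord, Pi.single_apply, mul_comm]

theorem measurable_kernelCoord (i : ι) : Measurable (kernelCoord p i) := by
  unfold kernelCoord; fun_prop

theorem measurable_kernelForm : Measurable (kernelForm p) := by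
  unfold kernelForm kernelCoord; fun_prop

theorem polyGrowth_kernelCoord (i : ι) : PolyGrowth (kernelCoord p i) :=
  PolyGrowth.sum _ fun j => (PolyGrowth.eval j).const_mul _

/-- Idempotence read on the diagonal. It makes `p i i` the variance of the `i`-th projected
coordinate, so `√(p i i)` is the natural small scale throughout. -/
theorem IsProjKernel.sum_sq (hp : IsProjKernel p) (i : ι) : ∑ j, p i j ^ 2 = p i i := by
  rw [← hp.idem i i]
  exact Finset.sum_congr rfl fun j _ => by rw [hp.symm j i, sq]

theorem IsProjKernel.diag_nonneg (hp : IsProjKernel p) (i : ι) : 0 ≤ p i i := by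
  rw [← hp.sum_sq i]; positivity

theorem IsProjKernel.diag_le_one (hp : IsProjKernel p) (i : ι) : p i i ≤ 1 := by
  have h : p i i ^ 2 ≤ p i i := by
    conv_rhs => rw [← hp.sum_sq i]
    exact Finset.single_le_sum (f := fun j => p i j ^ 2) (fun j _ => sq_nonneg _)
      (Finset.mem_univ i)
  nlinarith [hp.diag_nonneg i]

theorem IsProjKernel.eq_zero_of_diag (hp : IsProjKernel p) {i : ι} (h : p i i = 0) (j : ι) :
    p i j = 0 := by
  have h1 := hp.sum_sq i
  rw [h, Finset.sum_eq_zero_iff_of_nonneg (fun j _ => sq_nonneg _)] at h1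
  simpa using h1 j (Finset.mem_univ j)

theorem IsProjKernel.sum_mul_coord (hp : IsProjKernel p) (i : ι) (z : ι → ℝ) :
    ∑ j, p i j * kernelCoord p j z = kernelCoord p i z := by
  simp only [kernelCoord, Finset.mul_sum]
  rw [Finset.sum_comm]
  refine Finset.sum_congr rfl fun k _ => ?_
  rw [← hp.idem i k, Finset.sum_mul]
  exact Finset.sum_congr rfl fun j _ => by ring

theorem hasDerivAt_kernelCoord {z : ℝ → ι → ℝ} {z' : ι → ℝ} {u : ℝ}
    (hz : ∀ k, HasDerivAt (fun u => z u k) (z' k) u) (i : ι) :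
    HasDerivAt (fun u => kernelCoord p i (z u)) (kernelCoord p i z') u := by
  unfold kernelCoord
  exact HasDerivAt.fun_sum fun j _ => (hz j).const_mul _

theorem hasDerivAt_kernelForm (hs : ∀ i j, p i j = p j i) {z : ℝ → ι → ℝ} {z' : ι → ℝ} {u : ℝ}
    (hz : ∀ k, HasDerivAt (fun u => z u k) (z' k) u) :
    HasDerivAt (fun u => kernelForm p (z u)) (2 * ∑ i, kernelCoord p i (z u) * z' i) u := by
  unfold kernelForm
  refine (HasDerivAt.fun_sum fun i _ =>
    (hz i).mul (hasDerivAt_kernelCoord (p := p) hz i)).congr_deriv ?_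
  rw [Finset.sum_add_distrib, two_mul]
  congr 1
  · exact Finset.sum_congr rfl fun i _ => by ring
  · simp only [kernelCoord, Finset.mul_sum, Finset.sum_mul]
    rw [Finset.sum_comm]
    refine Finset.sum_congr rfl fun i _ => Finset.sum_congr rfl fun j _ => ?_
    rw [hs j i]; ring

variable {h h₁ h₂ h₃ : ℝ → ℝ} {B : ℝ}

/-- The `i`-th partial derivative of `h ∘ kernelForm p`. -/
def formGrad (p : ι → ι → ℝ) (h₁ : ℝ → ℝ) (i : ι) (z : ι → ℝ) : ℝ :=
  2 * h₁ (kernelForm p z) * kernelCoord p i z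

/-- The second partial derivative of `h ∘ kernelForm p` in the `i`-th coordinate. -/
def formHess (p : ι → ι → ℝ) (h₁ h₂ : ℝ → ℝ) (i : ι) (z : ι → ℝ) : ℝ :=
  2 * h₁ (kernelForm p z) * p i i + 4 * h₂ (kernelForm p z) * kernelCoord p i z ^ 2

/-- The `j`-th partial derivative of the `i`-th second partial derivative of
`h ∘ kernelForm p`. -/
def formThird (p : ι → ι → ℝ) (h₂ h₃ : ℝ → ℝ) (i j : ι) (z : ι → ℝ) : ℝ :=
  4 * h₂ (kernelForm p z) * kernelCoord p j z * p i i +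
    8 * h₃ (kernelForm p z) * kernelCoord p i z ^ 2 * kernelCoord p j z +
    8 * h₂ (kernelForm p z) * kernelCoord p i z * p i j

/-- An arbitrary curve of velocity `c` along one axis serves two purposes: varying the Gaussian
noise (velocity `c`) and shifting the base point (velocity 1). -/
theorem hasDerivAt_formGrad [DecidableEq ι] (hp : IsProjKernel p) (H : IsSmoothTest h h₁ h₂ h₃ B)
    {z : ℝ → ι → ℝ} {c : ℝ} {u : ℝ} (i : ι)
    (hz : ∀ k, HasDerivAt (fun u => z u k) ((Pi.single i c : ι → ℝ) k) u) :
    HasDerivAt (fun u => formGrad p h₁ i (z u)) (c * formHess p h₁ h₂ i (z u)) u := by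
  have hQ := hasDerivAt_kernelForm hp.symm hz
  have hm := hasDerivAt_kernelCoord (p := p) hz i
  have h1 := (((H.deriv₂ _).comp u hQ).const_mul 2).mul hm
  refine h1.congr_deriv ?_
  simp only [kernelCoord_single, formHess, Function.comp, Pi.single_apply, mul_ite, mul_zero,
    Finset.sum_ite_eq', Finset.mem_univ, if_true]
  ring

theorem hasDerivAt_formHess [DecidableEq ι] (hp : IsProjKernel p) (H : IsSmoothTest h h₁ h₂ h₃ B)
    {z : ℝ → ι → ℝ} {c : ℝ} {u : ℝ} (i j : ι)
    (hz : ∀ k, HasDerivAt (fun u => z u k) ((Pi.single j c : ι → ℝ) k) u) :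
    HasDerivAt (fun u => formHess p h₁ h₂ i (z u)) (c * formThird p h₂ h₃ i j (z u)) u := by
  have hQ := hasDerivAt_kernelForm hp.symm hz
  have hm := hasDerivAt_kernelCoord (p := p) hz i
  have h1 := ((((H.deriv₂ _).comp u hQ).const_mul 2).mul_const (p i i)).add
    ((((H.deriv₃ _).comp u hQ).const_mul 4).mul (hm.pow 2))
  refine h1.congr_deriv ?_
  simp only [kernelCoord_single, formThird, Function.comp, Pi.single_apply, mul_ite, mul_zero,
    Finset.sum_ite_eq', Finset.mem_univ, if_true, Pi.pow_apply]
  push_cast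
  ring

theorem abs_formGrad_le (H : IsSmoothTest h h₁ h₂ h₃ B) (i : ι) (z : ι → ℝ) :
    |formGrad p h₁ i z| ≤ 2 * |kernelCoord p i z| := by
  unfold formGrad
  rw [abs_mul, abs_mul, abs_two]
  have := H.bound₁ (kernelForm p z)
  have := mul_le_mul_of_nonneg_right this (abs_nonneg (kernelCoord p i z))
  linarith

theorem abs_formHess_le (H : IsSmoothTest h h₁ h₂ h₃ B) (hp : IsProjKernel p) (i : ι)
    (z : ι → ℝ) : |formHess p h₁ h₂ i z| ≤ 2 * p i i + 4 * kernelCoord p i z ^ 2 := by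
  unfold formHess
  refine (abs_add_le _ _).trans ?_
  rw [abs_mul, abs_mul, abs_mul, abs_mul, abs_two, abs_of_nonneg (hp.diag_nonneg i),
    abs_of_nonneg (sq_nonneg (kernelCoord p i z)), abs_of_pos (by norm_num : (0:ℝ) < 4)]
  have h1 := mul_le_mul_of_nonneg_right (H.bound₁ (kernelForm p z)) (hp.diag_nonneg i)
  have h2 := mul_le_mul_of_nonneg_right (H.bound₂ (kernelForm p z))
    (sq_nonneg (kernelCoord p i z))
  linarith

theorem abs_formThird_le (H : IsSmoothTest h h₁ h₂ h₃ B) (hp : IsProjKernel p) (i j : ι)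
    (z : ι → ℝ) : |formThird p h₂ h₃ i j z| ≤ 4 * |kernelCoord p j z| * p i i +
      8 * B * |kernelCoord p i z| ^ 2 * |kernelCoord p j z| +
      8 * |kernelCoord p i z| * |p i j| := by
  unfold formThird
  refine (abs_add_le _ _).trans (add_le_add ((abs_add_le _ _).trans (add_le_add ?_ ?_)) ?_)
  · rw [abs_mul, abs_mul, abs_mul, abs_of_nonneg (hp.diag_nonneg i),
      abs_of_pos (by norm_num : (0:ℝ) < 4)]
    have := H.bound₂ (kernelForm p z)
    have := hp.diag_nonneg i
    gcongr
    linarith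
  · rw [abs_mul, abs_mul, abs_mul, abs_pow, abs_of_pos (by norm_num : (0:ℝ) < 8)]
    have := H.bound₃ (kernelForm p z)
    gcongr
  · rw [abs_mul, abs_mul, abs_mul, abs_of_pos (by norm_num : (0:ℝ) < 8)]
    have := H.bound₂ (kernelForm p z)
    gcongr
    linarith

theorem measurable_formGrad (H : IsSmoothTest h h₁ h₂ h₃ B) (i : ι) :
    Measurable (formGrad p h₁ i) :=
  ((H.measurable₁.comp measurable_kernelForm).const_mul 2).mul (measurable_kernelCoord i)

theorem measurable_formHess (H : IsSmoothTest h h₁ h₂ h₃ B) (i : ι) :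
    Measurable (formHess p h₁ h₂ i) :=
  (((H.measurable₁.comp measurable_kernelForm).const_mul 2).mul_const _).add
    (((H.measurable₂.comp measurable_kernelForm).const_mul 4).mul
      ((measurable_kernelCoord i).pow_const 2))

theorem measurable_formThird (H : IsSmoothTest h h₁ h₂ h₃ B) (i j : ι) :
    Measurable (formThird p h₂ h₃ i j) :=
  (((((H.measurable₂.comp measurable_kernelForm).const_mul 4).mul
      (measurable_kernelCoord j)).mul_const _).add
    ((((H.measurable₃.comp measurable_kernelForm).const_mul 8).mul
      ((measurable_kernelCoord i).pow_const 2)).mul (measurable_kernelCoord j))).add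
    ((((H.measurable₂.comp measurable_kernelForm).const_mul 8).mul
      (measurable_kernelCoord i)).mul_const _)

theorem PolyGrowth.of_le {E : Type*} [NormedAddCommGroup E] [MeasurableSpace E] {F G : E → ℝ}
    (hF : Measurable F) (hG : PolyGrowth G) (h : ∀ y, |F y| ≤ G y) : PolyGrowth F := by
  obtain ⟨-, C, k, hC⟩ := hG
  exact ⟨hF, C, k, fun y => (h y).trans ((le_abs_self _).trans (hC y))⟩

theorem polyGrowth_kernelCoord_affine (a : ι → ℝ) (c : ℝ) (i : ι) :
    PolyGrowth fun y : ι → ℝ => kernelCoord p i (a + c • y) := by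
  simp only [kernelCoord_add, kernelCoord_smul]
  exact (PolyGrowth.const _).add ((polyGrowth_kernelCoord i).const_mul c)

theorem measurable_affine {ι : Type*} (a : ι → ℝ) (c : ℝ) : Measurable fun y : ι → ℝ => a + c • y := by
  fun_prop

theorem polyGrowth_formGrad (H : IsSmoothTest h h₁ h₂ h₃ B) (a : ι → ℝ) (c : ℝ)
    (i : ι) : PolyGrowth fun y : ι → ℝ => formGrad p h₁ i (a + c • y) :=
  PolyGrowth.of_le ((measurable_formGrad H i).comp (measurable_affine a c))
    ((polyGrowth_kernelCoord_affine a c i).abs.const_mul 2) fun _ => abs_formGrad_le H i _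

theorem polyGrowth_formHess (hp : IsProjKernel p) (H : IsSmoothTest h h₁ h₂ h₃ B) (a : ι → ℝ)
    (c : ℝ) (i : ι) : PolyGrowth fun y : ι → ℝ => formHess p h₁ h₂ i (a + c • y) :=
  PolyGrowth.of_le ((measurable_formHess H i).comp (measurable_affine a c))
    ((PolyGrowth.const _).add (((polyGrowth_kernelCoord_affine a c i).pow 2).const_mul 4))
    fun _ => abs_formHess_le H hp i _

theorem polyGrowth_formThird (hp : IsProjKernel p) (H : IsSmoothTest h h₁ h₂ h₃ B) (a : ι → ℝ)
    (c : ℝ) (i j : ι) : PolyGrowth fun y : ι → ℝ => formThird p h₂ h₃ i j (a + c • y) :=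
  PolyGrowth.of_le ((measurable_formThird H i j).comp (measurable_affine a c))
    (((((polyGrowth_kernelCoord_affine a c j).abs.const_mul 4).mul (PolyGrowth.const (p i i))).add
      ((((polyGrowth_kernelCoord_affine a c i).abs.pow 2).const_mul (8 * B)).mul
        (polyGrowth_kernelCoord_affine a c j).abs)).add
      (((polyGrowth_kernelCoord_affine a c i).abs.const_mul 8).mul (PolyGrowth.const |p i j|)))
    fun _ => abs_formThird_le H hp i j _

end kernel

/-! ### Gaussian smoothing of the derivatives of the form. -/

/-- The standard Gaussian law on `ι → ℝ`. -/
noncomputable abbrev gaussianPi (ι : Type*) [Fintype ι] : Measure (ι → ℝ) :=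
  Measure.pi fun _ : ι => gaussianReal 0 1

/-- The Gaussian smoothing at scale `c` of a function of several variables. -/
noncomputable def gaussianSmooth {ι : Type*} [Fintype ι] (c : ℝ) (G : (ι → ℝ) → ℝ) (a : ι → ℝ) :
    ℝ :=
  ∫ y, G (a + c • y) ∂gaussianPi ι

section smoothing
variable {ι : Type*} [Fintype ι] [DecidableEq ι] {p : ι → ι → ℝ}

theorem hasDerivAt_affine_update (a y : ι → ℝ) (c : ℝ) (j k : ι) (u : ℝ) :
    HasDerivAt (fun u => (a + c • Function.update y j u) k) ((Pi.single j c : ι → ℝ) k) u := by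
  by_cases hk : k = j
  · subst hk
    simpa using ((hasDerivAt_id u).const_mul c).const_add (a k)
  · simpa [Function.update_of_ne hk, Pi.single_eq_of_ne hk] using
      hasDerivAt_const u (a k + c * y k)

theorem hasDerivAt_add_single (a y : ι → ℝ) (j k : ι) (u : ℝ) :
    HasDerivAt (fun u => (a + (Pi.single j u : ι → ℝ) + y) k) ((Pi.single j 1 : ι → ℝ) k) u := by
  by_cases hk : k = j
  · subst hk
    simpa using ((hasDerivAt_id u).const_add (a k)).add_const (y k)
  · simpa [Pi.single_eq_of_ne hk] using hasDerivAt_const u (a k + y k)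

theorem integral_kernelCoord_mul_eq (i : ι) {G : (ι → ℝ) → ℝ} (hG : PolyGrowth G) :
    ∫ y, kernelCoord p i y * G y ∂gaussianPi ι = ∑ j, p i j * ∫ y, y j * G y ∂gaussianPi ι := by
  simp only [kernelCoord, Finset.sum_mul]
  rw [integral_finsetSum]
  · refine Finset.sum_congr rfl fun j _ => ?_
    rw [← integral_const_mul]
    congr 1; ext y; ring
  · exact fun j _ =>
      (((PolyGrowth.eval j).const_mul (p i j)).mul hG).integrable_pi_gaussianReal

theorem integral_kernelCoord_sq (hp : IsProjKernel p) (i : ι) :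
    ∫ y, kernelCoord p i y ^ 2 ∂gaussianPi ι = p i i := by
  simp only [sq]
  rw [integral_kernelCoord_mul_eq i (polyGrowth_kernelCoord i)]
  rw [← hp.sum_sq i]
  refine Finset.sum_congr rfl fun j _ => ?_
  rw [integral_eval_mul_pi_gaussianReal j (G' := fun _ => p i j) (polyGrowth_kernelCoord i)
    (PolyGrowth.const _)]
  · simp [sq]
  · intro y a
    have := hasDerivAt_kernelCoord (p := p) (fun k => hasDerivAt_affine_update 0 y 1 j k a) i
    simpa [kernelCoord_single] using this

theorem integral_kernelCoord_pow_four (hp : IsProjKernel p) (i : ι) :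
    ∫ y, kernelCoord p i y ^ 4 ∂gaussianPi ι = 3 * p i i ^ 2 := by
  have h1 : ∀ y : ι → ℝ, kernelCoord p i y ^ 4 = kernelCoord p i y * kernelCoord p i y ^ 3 :=
    fun y => by ring
  simp only [h1]
  rw [integral_kernelCoord_mul_eq i ((polyGrowth_kernelCoord i).pow 3)]
  have h2 : ∀ j, ∫ y, y j * kernelCoord p i y ^ 3 ∂gaussianPi ι = 3 * p i i * p i j := by
    intro j
    rw [integral_eval_mul_pi_gaussianReal j (G' := fun y => 3 * kernelCoord p i y ^ 2 * p i j)
      ((polyGrowth_kernelCoord i).pow 3)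
      ((((polyGrowth_kernelCoord i).pow 2).const_mul 3).mul (PolyGrowth.const _)),
      integral_mul_const, integral_const_mul, integral_kernelCoord_sq hp]
    intro y a
    have := hasDerivAt_kernelCoord (p := p) (fun k => hasDerivAt_affine_update 0 y 1 j k a) i
    simpa [kernelCoord_single] using this.fun_pow 3
  simp only [h2]
  rw [sq, ← mul_assoc]
  conv_rhs => rw [← hp.sum_sq i, Finset.mul_sum]
  rw [hp.sum_sq i]
  exact Finset.sum_congr rfl fun j _ => by ring

theorem kernelCoord_eq_zero_of_diag (hp : IsProjKernel p) {i : ι} (h : p i i = 0) (y : ι → ℝ) :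
    kernelCoord p i y = 0 := by
  simp [kernelCoord, hp.eq_zero_of_diag h]

/-- With `τ = √(p i i)`, the inequality `|m| ≤ (τ + m² / τ) / 2` reduces odd absolute moments to the
second and fourth ones, which are `τ²` and `3 τ⁴`. -/
theorem integral_abs_kernelCoord_mul_le (hp : IsProjKernel p) (i : ι) {α β : ℝ} (hα : 0 ≤ α)
    (hβ : 0 ≤ β) :
    ∫ y, |kernelCoord p i y| * (α + β * kernelCoord p i y ^ 2) ∂gaussianPi ι ≤
      √(p i i) * (α + 2 * β * p i i) := by
  -- A zero diagonal entry forces a zero row, so division by `τ` is only needed when `τ > 0`.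
  rcases (hp.diag_nonneg i).eq_or_lt with h0 | h0
  · simp [kernelCoord_eq_zero_of_diag hp h0.symm, ← h0]
  set τ := √(p i i) with hτ
  have hτ0 : 0 < τ := Real.sqrt_pos.2 h0
  have hτ2 : p i i = τ ^ 2 := (Real.sq_sqrt h0.le).symm
  have hm := polyGrowth_kernelCoord (p := p) i
  have hle : ∀ y : ι → ℝ, |kernelCoord p i y| * (α + β * kernelCoord p i y ^ 2) ≤
      α * τ / 2 + (α / τ / 2 + β * τ / 2) * kernelCoord p i y ^ 2 +
        β / τ / 2 * kernelCoord p i y ^ 4 := by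
    intro y
    set m := kernelCoord p i y
    have h1 : |m| ≤ (τ + m ^ 2 / τ) / 2 := by
      rw [le_div_iff₀ two_pos, ← sub_nonneg]
      have : τ + m ^ 2 / τ - |m| * 2 = (τ - |m|) ^ 2 / τ := by
        field_simp
        rw [← sq_abs m]; ring
      rw [this]; positivity
    calc |m| * (α + β * m ^ 2) ≤ (τ + m ^ 2 / τ) / 2 * (α + β * m ^ 2) := by gcongr
      _ = _ := by field_simp; ring
  calc ∫ y, |kernelCoord p i y| * (α + β * kernelCoord p i y ^ 2) ∂gaussianPi ι
      ≤ ∫ y, (α * τ / 2 + (α / τ / 2 + β * τ / 2) * kernelCoord p i y ^ 2 +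
        β / τ / 2 * kernelCoord p i y ^ 4) ∂gaussianPi ι := by
        refine integral_mono (PolyGrowth.integrable_pi_gaussianReal ?_)
          (PolyGrowth.integrable_pi_gaussianReal ?_) hle
        · exact hm.abs.mul ((PolyGrowth.const _).add ((hm.pow 2).const_mul _))
        · exact ((PolyGrowth.const _).add ((hm.pow 2).const_mul _)).add ((hm.pow 4).const_mul _)
    _ = τ * (α + 2 * β * p i i) := by
        rw [integral_add, integral_add, integral_const_mul, integral_const_mul,
          integral_kernelCoord_sq hp, integral_kernelCoord_pow_four hp]
        · simp only [integral_const, probReal_univ, smul_eq_mul, one_mul]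
          rw [hτ2]; field_simp; ring
        · exact (PolyGrowth.const _).integrable_pi_gaussianReal
        · exact ((hm.pow 2).const_mul _).integrable_pi_gaussianReal
        · exact ((PolyGrowth.const _).add ((hm.pow 2).const_mul _)).integrable_pi_gaussianReal
        · exact ((hm.pow 4).const_mul _).integrable_pi_gaussianReal

theorem abs_integral_le_of_abs_le {F G : (ι → ℝ) → ℝ} (hG : PolyGrowth G) (h : ∀ y, |F y| ≤ G y) :
    |∫ y, F y ∂gaussianPi ι| ≤ ∫ y, G y ∂gaussianPi ι :=
  (Real.norm_eq_abs _).symm.trans_le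
    (norm_integral_le_of_norm_le hG.integrable_pi_gaussianReal (Filter.Eventually.of_forall h))

variable {h h₁ h₂ h₃ : ℝ → ℝ} {B : ℝ}

theorem integral_eval_mul_formGrad (hp : IsProjKernel p) (H : IsSmoothTest h h₁ h₂ h₃ B)
    (a : ι → ℝ) (c : ℝ) (i : ι) :
    ∫ y, y i * formGrad p h₁ i (a + c • y) ∂gaussianPi ι =
      c * gaussianSmooth c (formHess p h₁ h₂ i) a := by
  rw [gaussianSmooth, ← integral_const_mul]
  exact integral_eval_mul_pi_gaussianReal i (polyGrowth_formGrad H a c i)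
    ((polyGrowth_formHess hp H a c i).const_mul c)
    fun y u => hasDerivAt_formGrad hp H i fun k => hasDerivAt_affine_update a y c i k u

/-- Integration by parts produces `∑ j, p i j * formThird i j`. The identities `∑ j, p i j * (p z) j
= (p z) i` and `∑ j, p i j ^ 2 = p i i` collapse this sum to `formThird i i`, so the third-order
term is expressed through the second-order one. -/
theorem integral_kernelCoord_mul_formHess (hp : IsProjKernel p) (H : IsSmoothTest h h₁ h₂ h₃ B)
    (a : ι → ℝ) (c : ℝ) (i : ι) :
    ∫ y, kernelCoord p i y * formHess p h₁ h₂ i (a + c • y) ∂gaussianPi ι =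
      c * gaussianSmooth c (formThird p h₂ h₃ i i) a := by
  rw [integral_kernelCoord_mul_eq i (polyGrowth_formHess hp H a c i)]
  have h1 : ∀ j, ∫ y, y j * formHess p h₁ h₂ i (a + c • y) ∂gaussianPi ι =
      ∫ y, c * formThird p h₂ h₃ i j (a + c • y) ∂gaussianPi ι := fun j =>
    integral_eval_mul_pi_gaussianReal j (polyGrowth_formHess hp H a c i)
      ((polyGrowth_formThird hp H a c i j).const_mul c)
      fun y u => hasDerivAt_formHess hp H i j fun k => hasDerivAt_affine_update a y c j k u
  simp only [h1, ← integral_const_mul]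
  rw [gaussianSmooth, ← integral_const_mul, ← integral_finsetSum]
  · congr 1
    ext y
    have e := hp.sum_mul_coord i (a + c • y)
    simp only [formThird]
    have e1 : ∀ X Y Z : ℝ, ∑ j, p i j * (c * (X * kernelCoord p j (a + c • y) * p i i +
        Y * kernelCoord p j (a + c • y) + Z * p i j)) = c * (X * kernelCoord p i (a + c • y) *
        p i i + Y * kernelCoord p i (a + c • y) + Z * p i i) := by
      intro X Y Z
      have e2 : X * kernelCoord p i (a + c • y) * p i i + Y * kernelCoord p i (a + c • y) +
          Z * p i i = (X * p i i + Y) * (∑ j, p i j * kernelCoord p j (a + c • y)) +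
          Z * ∑ j, p i j ^ 2 := by
        rw [e, hp.sum_sq i]; ring
      rw [e2]
      simp only [Finset.mul_sum, ← Finset.sum_add_distrib]
      exact Finset.sum_congr rfl fun j _ => by ring
    rw [e1]
  · exact fun j _ => PolyGrowth.integrable_pi_gaussianReal
      (((polyGrowth_formThird hp H a c i j).const_mul c).const_mul _)

theorem abs_gaussianSmooth_formGrad_le (hp : IsProjKernel p) (H : IsSmoothTest h h₁ h₂ h₃ B)
    (a : ι → ℝ) {c : ℝ} (hc0 : 0 ≤ c) (hc1 : c ≤ 1) (i : ι) :
    |gaussianSmooth c (formGrad p h₁ i) a| ≤ 2 * (|kernelCoord p i a| + √(p i i)) := by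
  have hm := polyGrowth_kernelCoord (p := p) i
  refine (abs_integral_le_of_abs_le (G := fun y => 2 * |kernelCoord p i a| +
    |kernelCoord p i y| * (2 + 0 * kernelCoord p i y ^ 2))
    ((PolyGrowth.const _).add (hm.abs.mul ((PolyGrowth.const _).add ((hm.pow 2).const_mul 0))))
    fun y => ?_).trans ?_
  · refine (abs_formGrad_le H i _).trans ?_
    rw [kernelCoord_add, kernelCoord_smul]
    have h1 := abs_add_le (kernelCoord p i a) (c * kernelCoord p i y)
    rw [abs_mul, abs_of_nonneg hc0] at h1
    have h2 := mul_le_mul_of_nonneg_right hc1 (abs_nonneg (kernelCoord p i y))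
    linarith
  · rw [integral_add (PolyGrowth.const _).integrable_pi_gaussianReal
      (hm.abs.mul ((PolyGrowth.const _).add ((hm.pow 2).const_mul 0))).integrable_pi_gaussianReal]
    have := integral_abs_kernelCoord_mul_le hp i (zero_le_two (α := ℝ)) le_rfl
    simp only [integral_const, probReal_univ, smul_eq_mul, one_mul] at this ⊢
    linarith

theorem abs_formHess_affine_le (hp : IsProjKernel p) (H : IsSmoothTest h h₁ h₂ h₃ B)
    (a y : ι → ℝ) {c : ℝ} (hc0 : 0 ≤ c) (hc1 : c ≤ 1) (i : ι) :
    |formHess p h₁ h₂ i (a + c • y)| ≤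
      2 * p i i + 8 * kernelCoord p i a ^ 2 + 8 * kernelCoord p i y ^ 2 := by
  refine (abs_formHess_le H hp i _).trans ?_
  rw [kernelCoord_add, kernelCoord_smul]
  have h1 : (c * kernelCoord p i y) ^ 2 ≤ kernelCoord p i y ^ 2 := by
    rw [mul_pow]
    exact mul_le_of_le_one_left (sq_nonneg _) (pow_le_one₀ hc0 hc1)
  nlinarith [sq_nonneg (kernelCoord p i a - c * kernelCoord p i y)]

theorem abs_gaussianSmooth_formHess_le (hp : IsProjKernel p) (H : IsSmoothTest h h₁ h₂ h₃ B)
    (a : ι → ℝ) {c : ℝ} (hc0 : 0 ≤ c) (hc1 : c ≤ 1) (i : ι) :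
    |gaussianSmooth c (formHess p h₁ h₂ i) a| ≤ 10 * (p i i + kernelCoord p i a ^ 2) := by
  have hm := polyGrowth_kernelCoord (p := p) i
  refine (abs_integral_le_of_abs_le (G := fun y => 2 * p i i + 8 * kernelCoord p i a ^ 2 +
    8 * kernelCoord p i y ^ 2) ((PolyGrowth.const _).add ((hm.pow 2).const_mul 8))
    fun y => abs_formHess_affine_le hp H a y hc0 hc1 i).trans ?_
  rw [integral_add (PolyGrowth.const _).integrable_pi_gaussianReal
    ((hm.pow 2).const_mul 8).integrable_pi_gaussianReal, integral_const_mul,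
    integral_kernelCoord_sq hp]
  simp only [integral_const, probReal_univ, smul_eq_mul, one_mul]
  nlinarith [sq_nonneg (kernelCoord p i a)]

/-- The bound is free of `B`: the third derivative has been integrated away against the Gaussian
weight, at the price of the factor `1 / c`. -/
theorem abs_gaussianSmooth_formThird_le (hp : IsProjKernel p) (H : IsSmoothTest h h₁ h₂ h₃ B)
    (a : ι → ℝ) {c : ℝ} (hc0 : 0 < c) (hc1 : c ≤ 1) (i : ι) :
    |gaussianSmooth c (formThird p h₂ h₃ i i) a| ≤
      18 / c * √(p i i) * (p i i + kernelCoord p i a ^ 2) := by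
  have hm := polyGrowth_kernelCoord (p := p) i
  have h1 : |c * gaussianSmooth c (formThird p h₂ h₃ i i) a| ≤
      √(p i i) * (2 * p i i + 8 * kernelCoord p i a ^ 2 + 2 * 8 * p i i) := by
    rw [← integral_kernelCoord_mul_formHess hp H]
    refine (abs_integral_le_of_abs_le (G := fun y => |kernelCoord p i y| *
      (2 * p i i + 8 * kernelCoord p i a ^ 2 + 8 * kernelCoord p i y ^ 2))
      (hm.abs.mul ((PolyGrowth.const _).add ((hm.pow 2).const_mul 8))) fun y => ?_).trans
      (integral_abs_kernelCoord_mul_le hp i ?_ (by norm_num))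
    · rw [abs_mul]
      gcongr
      exact abs_formHess_affine_le hp H a y hc0.le hc1 i
    · have := hp.diag_nonneg i
      positivity
  rw [abs_mul, abs_of_pos hc0, mul_comm, ← le_div_iff₀ hc0] at h1
  refine h1.trans ?_
  rw [div_mul_eq_mul_div, div_mul_eq_mul_div]
  refine div_le_div_of_nonneg_right ?_ hc0.le
  have := mul_nonneg (Real.sqrt_nonneg (p i i)) (sq_nonneg (kernelCoord p i a))
  linarith

/-- Differentiation under the integral; a dominating function is required only for shifts within
distance 1 of `u₀`, which polynomially growing derivatives allow. -/
theorem hasDerivAt_gaussianSmooth (c : ℝ) (a : ι → ℝ) (i : ι) {F F' : (ι → ℝ) → ℝ}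
    (hF : ∀ a, PolyGrowth fun y => F (a + c • y)) (hF' : Measurable F')
    (hd : ∀ (y : ι → ℝ) u, HasDerivAt (fun u => F (a + (Pi.single i u : ι → ℝ) + c • y))
      (F' (a + (Pi.single i u : ι → ℝ) + c • y)) u) (u₀ : ℝ) {G : (ι → ℝ) → ℝ} (hG : PolyGrowth G)
    (hb : ∀ (y : ι → ℝ) u, u ∈ Metric.ball u₀ 1 →
      |F' (a + (Pi.single i u : ι → ℝ) + c • y)| ≤ G y) :
    HasDerivAt (fun u => gaussianSmooth c F (a + (Pi.single i u : ι → ℝ)))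
      (gaussianSmooth c F' (a + (Pi.single i u₀ : ι → ℝ))) u₀ := by
  unfold gaussianSmooth
  refine (hasDerivAt_integral_of_dominated_loc_of_deriv_le (Metric.ball_mem_nhds u₀ one_pos)
    (bound := G) (F' := fun u y => F' (a + (Pi.single i u : ι → ℝ) + c • y))
    (Filter.Eventually.of_forall fun u => (hF _).1.aestronglyMeasurable)
    (hF _).integrable_pi_gaussianReal
    (hF'.comp (measurable_affine _ c)).aestronglyMeasurable
    (Filter.Eventually.of_forall hb) hG.integrable_pi_gaussianReal
    (Filter.Eventually.of_forall fun y u _ => hd y u)).2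

theorem abs_kernelCoord_add_single_le (a y : ι → ℝ) (c : ℝ) (i : ι) {u u₀ : ℝ}
    (hu : u ∈ Metric.ball u₀ 1) :
    |kernelCoord p i (a + (Pi.single i u : ι → ℝ) + c • y)| ≤
      |kernelCoord p i a| + (|u₀| + 1) * |p i i| + |c| * |kernelCoord p i y| := by
  rw [kernelCoord_add, kernelCoord_add, kernelCoord_smul, kernelCoord_single]
  have h1 : |u| ≤ |u₀| + 1 := by
    rw [Metric.mem_ball, Real.dist_eq] at hu
    have := abs_sub_abs_le_abs_sub u u₀
    linarith
  refine (abs_add_le _ _).trans (add_le_add ((abs_add_le _ _).trans (add_le_add le_rfl ?_)) ?_)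
  · rw [abs_mul]; gcongr
  · rw [abs_mul]

theorem hasDerivAt_gaussianSmooth_formGrad (hp : IsProjKernel p) (H : IsSmoothTest h h₁ h₂ h₃ B)
    (a : ι → ℝ) (c : ℝ) (i : ι) (u : ℝ) :
    HasDerivAt (fun u => gaussianSmooth c (formGrad p h₁ i) (a + (Pi.single i u : ι → ℝ)))
      (gaussianSmooth c (formHess p h₁ h₂ i) (a + (Pi.single i u : ι → ℝ))) u := by
  have hm := polyGrowth_kernelCoord (p := p) i
  refine hasDerivAt_gaussianSmooth c a i (fun a => polyGrowth_formGrad H a c i)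
    (measurable_formHess H i) (fun y u => ?_) u
    (G := fun y => 2 * p i i + 4 * (|kernelCoord p i a| + (|u| + 1) * |p i i| +
      |c| * |kernelCoord p i y|) ^ 2)
    ((PolyGrowth.const _).add ((((PolyGrowth.const _).add (hm.abs.const_mul _)).pow 2).const_mul 4))
    fun y v hv => ?_
  · simpa using hasDerivAt_formGrad hp H i (c := 1)
      fun k => hasDerivAt_add_single a (c • y) i k u
  · refine (abs_formHess_le H hp i _).trans ?_
    have := abs_kernelCoord_add_single_le (p := p) a y c i hv
    rw [← sq_abs (kernelCoord p i _)]
    gcongr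

/-- The constant `B` enters only qualitatively, in the dominating function. -/
theorem hasDerivAt_gaussianSmooth_formHess (hp : IsProjKernel p) (H : IsSmoothTest h h₁ h₂ h₃ B)
    (a : ι → ℝ) (c : ℝ) (i : ι) (u : ℝ) :
    HasDerivAt (fun u => gaussianSmooth c (formHess p h₁ h₂ i) (a + (Pi.single i u : ι → ℝ)))
      (gaussianSmooth c (formThird p h₂ h₃ i i) (a + (Pi.single i u : ι → ℝ))) u := by
  have hm := polyGrowth_kernelCoord (p := p) i
  set R : (ι → ℝ) → ℝ := fun y => |kernelCoord p i a| + (|u| + 1) * |p i i| +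
    |c| * |kernelCoord p i y| with hR
  have hRg : PolyGrowth R := (PolyGrowth.const _).add (hm.abs.const_mul _)
  refine hasDerivAt_gaussianSmooth c a i (fun a => polyGrowth_formHess hp H a c i)
    (measurable_formThird H i i) (fun y u => ?_) u
    (G := fun y => 4 * R y * p i i + 8 * B * R y ^ 2 * R y + 8 * R y * |p i i|)
    ((((hRg.const_mul 4).mul (PolyGrowth.const _)).add (((hRg.pow 2).const_mul _).mul hRg)).add
      ((hRg.const_mul 8).mul (PolyGrowth.const _)))
    fun y v hv => ?_
  · simpa using hasDerivAt_formHess hp H i i (c := 1)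
      fun k => hasDerivAt_add_single a (c • y) i k u
  · refine (abs_formThird_le H hp i i _).trans ?_
    have := abs_kernelCoord_add_single_le (p := p) a y c i hv
    have := hp.diag_nonneg i
    have := H.nonneg
    have : 0 ≤ R y := (abs_nonneg _).trans ‹|kernelCoord p i (a + _ + c • y)| ≤ _›
    gcongr

end smoothing

/-! ### The one-dimensional Stein discrepancy. -/

theorem abs_sub_le_of_hasDerivAt {g g' : ℝ → ℝ} (hg : ∀ x, HasDerivAt g (g' x) x) {u L : ℝ}
    (hL : ∀ v, |v| ≤ |u| → |g' v| ≤ L) : |g u - g 0| ≤ L * |u| := by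
  have h1 := Convex.norm_image_sub_le_of_norm_hasDerivWithin_le (f := g) (f' := g')
    (s := Set.Icc (-|u|) |u|) (x := 0) (y := u) (C := L) (fun x _ => (hg x).hasDerivWithinAt)
    (fun x hx => hL x (abs_le.2 hx)) (convex_Icc _ _)
    (Set.mem_Icc.2 ⟨by simp, abs_nonneg _⟩) (abs_le.1 le_rfl)
  simpa using h1

/-- Moment conditions: mean zero, variance one, and fourth moment at most `M`. -/
structure HasNormalizedMoments (μ : Measure ℝ) (M : ℝ) : Prop where
  memLp : MemLp (fun a => a) 4 μ
  mean : ∫ a, a ∂μ = 0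
  second : ∫ a, a ^ 2 ∂μ = 1
  fourth : ∫ a, a ^ 4 ∂μ ≤ M

namespace HasNormalizedMoments
variable {μ : Measure ℝ} [IsProbabilityMeasure μ] {M : ℝ}

theorem integrable_four (h : HasNormalizedMoments μ M) : Integrable (fun a : ℝ => a ^ 4) μ := by
  have h1 : Integrable (fun a : ℝ => ‖a‖ ^ 4) μ := by
    have := h.memLp
    exact MemLp.integrable_norm_pow' (p := 4) (by exact_mod_cast this)
  refine h1.congr (Filter.Eventually.of_forall fun a => ?_)
  simp only [Real.norm_eq_abs]
  exact (by decide : Even 4).pow_abs a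

theorem integrable_one (h : HasNormalizedMoments μ M) : Integrable (fun a : ℝ => a) μ :=
  h.memLp.integrable (by norm_num)

theorem integrable_two (h : HasNormalizedMoments μ M) : Integrable (fun a : ℝ => a ^ 2) μ :=
  (h.memLp.mono_exponent (p := 2) (by norm_num)).integrable_sq

/-- Expand the expectation of `(a² - 1)² ≥ 0`. -/
theorem one_le (h : HasNormalizedMoments μ M) : 1 ≤ M := by
  have h1 : 0 ≤ ∫ a, (a ^ 4 - 2 * a ^ 2 + 1) ∂μ :=
    integral_nonneg fun a => by
      have : a ^ 4 - 2 * a ^ 2 + 1 = (a ^ 2 - 1) ^ 2 := by ring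
      simp only [Pi.zero_apply, this]; positivity
  have h2 : Integrable (fun a : ℝ => a ^ 4 - 2 * a ^ 2) μ :=
    h.integrable_four.sub (h.integrable_two.const_mul 2)
  rw [integral_add h2 (integrable_const _),
    integral_sub h.integrable_four (h.integrable_two.const_mul 2), integral_const_mul,
    h.second] at h1
  simp at h1
  linarith [h.fourth]

end HasNormalizedMoments

/-- A smoothed Stein identity: if `k` has a second derivative of order `τ ^ 3`, then
`E[a k(s a)] - s E[k'(s a)]` is of order `τ ^ 3`. -/
theorem abs_integral_mul_sub_deriv_le {k k' k'' : ℝ → ℝ} {τ A K s M : ℝ} (hτ0 : 0 ≤ τ)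
    (hτ1 : τ ≤ 1) (hK : 1 ≤ K) (hs0 : 0 ≤ s) (hs1 : s ≤ 1)
    (hk : ∀ u, HasDerivAt k (k' u) u) (hk' : ∀ u, HasDerivAt k' (k'' u) u)
    (b0 : ∀ u, |k u| ≤ 2 * (|A + u * τ ^ 2| + τ))
    (b1 : ∀ u, |k' u| ≤ 10 * (τ ^ 2 + (A + u * τ ^ 2) ^ 2))
    (b2 : ∀ u, |k'' u| ≤ 18 * K * τ * (τ ^ 2 + (A + u * τ ^ 2) ^ 2))
    {μ : Measure ℝ} [IsProbabilityMeasure μ] (hμ : HasNormalizedMoments μ M) :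
    |∫ a, (a * k (s * a) - s * k' (s * a)) ∂μ| ≤ 162 * K * M * τ * (τ ^ 2 + A ^ 2) := by
  set D := 54 * K * τ * (τ ^ 2 + A ^ 2) with hD
  have hD0 : 0 ≤ D := by positivity
  have hτ32 : τ ^ 3 ≤ τ ^ 2 := by nlinarith [sq_nonneg τ]
  have hb1' : ∀ u, |k' u| ≤ 20 * (τ ^ 2 + A ^ 2 + u ^ 2 * τ ^ 4) := fun u => by
    refine (b1 u).trans ?_
    nlinarith [sq_nonneg (A - u * τ ^ 2), sq_nonneg τ]
  -- In the range `τ |u| ≤ 1` the shift `v τ²` is at most `τ`, so `τ² + (A + v τ²)²` grows by a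
  -- factor of at most 3, whence 54 = 3 · 18. Outside it Taylor expansion is replaced by the crude
  -- bounds, multiplied by powers of `τ |u| > 1`.
  have small : ∀ u, τ * |u| ≤ 1 → ∀ v, |v| ≤ |u| → |k'' v| ≤ D := fun u hu v hv => by
    refine (b2 v).trans ?_
    have h1 : (v * τ ^ 2) ^ 2 ≤ τ ^ 2 := by
      have h2 : τ * |v| ≤ 1 := (mul_le_mul_of_nonneg_left hv hτ0).trans hu
      have h3 : (τ * |v|) ^ 2 ≤ 1 := pow_le_one₀ (by positivity) h2
      rw [mul_pow, sq_abs] at h3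
      nlinarith [sq_nonneg τ]
    have h2 : τ ^ 2 + (A + v * τ ^ 2) ^ 2 ≤ 3 * (τ ^ 2 + A ^ 2) := by
      nlinarith [sq_nonneg (A - v * τ ^ 2)]
    calc 18 * K * τ * (τ ^ 2 + (A + v * τ ^ 2) ^ 2) ≤ 18 * K * τ * (3 * (τ ^ 2 + A ^ 2)) := by
          gcongr
      _ = D := by rw [hD]; ring
  have E2 : ∀ u, |k' u - k' 0| ≤ D * (|u| + u ^ 2) := fun u => by
    by_cases hu : τ * |u| ≤ 1
    · refine (abs_sub_le_of_hasDerivAt hk' (small u hu)).trans ?_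
      gcongr
      nlinarith [sq_nonneg u]
    · push Not at hu
      have hu0 := abs_nonneg u
      have g1 : τ ^ 2 ≤ |u| * τ ^ 3 := by nlinarith [sq_nonneg τ]
      have g2 : A ^ 2 ≤ |u| * τ * A ^ 2 := by nlinarith [sq_nonneg A]
      have g3 : u ^ 2 * τ ^ 4 ≤ u ^ 2 * τ ^ 3 := by
        gcongr u ^ 2 * ?_
        exact pow_le_pow_of_le_one hτ0 hτ1 (by norm_num)
      have h0 := hb1' 0
      have h1 := hb1' u
      have h2 := abs_sub (k' u) (k' 0)
      have h3 : |k' u - k' 0| ≤ 40 * (τ * (τ ^ 2 + A ^ 2) * (|u| + u ^ 2)) := by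
        have : 0 ≤ u ^ 2 * τ * A ^ 2 := by positivity
        simp only [ne_eq, OfNat.ofNat_ne_zero, not_false_eq_true, zero_pow, zero_mul,
          add_zero] at h0
        nlinarith
      refine h3.trans ?_
      have h4 : 0 ≤ τ * (τ ^ 2 + A ^ 2) * (|u| + u ^ 2) := by positivity
      rw [hD]
      nlinarith
  -- The remainder must be quadratic in `u`, although a second-order Taylor bound is available only
  -- for `τ |u| ≤ 1`; for larger `u` the bounds `b0` and `b1` replace it.
  have E1 : ∀ u, |k u - k 0 - u * k' 0| ≤ D * u ^ 2 := fun u => by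
    by_cases hu : τ * |u| ≤ 1
    · have h1 : ∀ x, HasDerivAt (fun u => k u - u * k' 0) (k' x - k' 0) x := fun x => by
        simpa using (hk x).fun_sub ((hasDerivAt_id x).mul_const (k' 0))
      have h2 := abs_sub_le_of_hasDerivAt h1 (u := u) (L := D * |u|) fun v hv => by
        refine (abs_sub_le_of_hasDerivAt hk' (small v
          ((mul_le_mul_of_nonneg_left hv hτ0).trans hu))).trans ?_
        gcongr
      rw [mul_assoc, ← sq, sq_abs] at h2
      refine le_trans (le_of_eq ?_) h2
      congr 1; ring
    · push Not at hu
      have hu0 := abs_nonneg u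
      have hu2 : 1 ≤ u ^ 2 * τ ^ 2 := by
        rw [← sq_abs u]; nlinarith
      have hτpos : 0 < τ := by
        rcases hτ0.eq_or_lt with h | h
        · rw [← h] at hu; simp at hu; linarith
        · exact h
      have g1 : τ ≤ u ^ 2 * τ ^ 3 := by nlinarith
      have g2 : |u| * τ ^ 2 ≤ u ^ 2 * τ ^ 3 := by
        rw [← sq_abs u]
        nlinarith [mul_nonneg hu0 (sq_nonneg τ)]
      have g3 : |A| ≤ u ^ 2 * τ * (τ ^ 2 + A ^ 2) := by
        have : τ * |A| ≤ τ ^ 2 + A ^ 2 := by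
          rw [← sq_abs A]; nlinarith [sq_nonneg (τ - |A|), sq_nonneg (τ), sq_nonneg (|A|)]
        have h5 : u ^ 2 * τ * (τ * |A|) ≤ u ^ 2 * τ * (τ ^ 2 + A ^ 2) := by gcongr
        nlinarith [abs_nonneg A]
      have g4 : |u| * A ^ 2 ≤ u ^ 2 * τ * A ^ 2 := by
        rw [← sq_abs u]
        nlinarith [mul_nonneg hu0 (sq_nonneg A)]
      have h0 := b0 0
      have h1 := b0 u
      have h2 : |A + u * τ ^ 2| ≤ |A| + |u| * τ ^ 2 := by
        refine (abs_add_le _ _).trans ?_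
        rw [abs_mul, abs_of_nonneg (sq_nonneg τ)]
      have h3 := b1 0
      have h4 : |u * k' 0| ≤ |u| * (10 * (τ ^ 2 + A ^ 2)) := by
        rw [abs_mul]; gcongr; simpa using h3
      have h5 : |k u - k 0 - u * k' 0| ≤ |k u| + |k 0| + |u * k' 0| :=
        (abs_sub _ _).trans (add_le_add (abs_sub _ _) le_rfl)
      simp only [zero_mul, add_zero] at h0
      have h6 : |k u - k 0 - u * k' 0| ≤ 54 * (u ^ 2 * τ * (τ ^ 2 + A ^ 2)) := by
        have : 0 ≤ u ^ 2 * τ * A ^ 2 := by positivity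
        nlinarith
      refine h6.trans ?_
      have h7 : 0 ≤ u ^ 2 * τ * (τ ^ 2 + A ^ 2) := by positivity
      rw [hD]
      nlinarith
  have i4 := hμ.integrable_four
  have i2 := hμ.integrable_two
  have i1 := hμ.integrable_one
  have i21 : Integrable (fun a : ℝ => a ^ 2 - 1) μ := i2.sub (integrable_const 1)
  have hkc : Continuous k := continuous_iff_continuousAt.2 fun x => (hk x).continuousAt
  have hkc' : Continuous k' := continuous_iff_continuousAt.2 fun x => (hk' x).continuousAt
  have hi1 : Integrable (fun a => a * (k (s * a) - k 0 - s * a * k' 0) -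
      s * (k' (s * a) - k' 0)) μ ∧
      |∫ a, (a * (k (s * a) - k 0 - s * a * k' 0) - s * (k' (s * a) - k' 0)) ∂μ| ≤
        3 * D * M := by
    have hb : ∀ a, ‖a * (k (s * a) - k 0 - s * a * k' 0) - s * (k' (s * a) - k' 0)‖ ≤
        D * (1 / 2 + 2 * a ^ 2 + 1 / 2 * a ^ 4) := fun a => by
      rw [Real.norm_eq_abs]
      refine (abs_sub _ _).trans ?_
      rw [abs_mul, abs_mul, abs_of_nonneg hs0]
      have h1 : |a| * |k (s * a) - k 0 - s * a * k' 0| ≤ |a| * (D * a ^ 2) := by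
        refine mul_le_mul_of_nonneg_left ((E1 _).trans (mul_le_mul_of_nonneg_left ?_ hD0))
          (abs_nonneg a)
        rw [mul_pow]
        exact mul_le_of_le_one_left (sq_nonneg _) (pow_le_one₀ hs0 hs1)
      have h2 : s * |k' (s * a) - k' 0| ≤ 1 * (D * (|a| + a ^ 2)) := by
        refine mul_le_mul hs1 ((E2 _).trans (mul_le_mul_of_nonneg_left (add_le_add ?_ ?_) hD0))
          (abs_nonneg _) zero_le_one
        · rw [abs_mul, abs_of_nonneg hs0]
          exact mul_le_of_le_one_left (abs_nonneg _) hs1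
        · rw [mul_pow]
          exact mul_le_of_le_one_left (sq_nonneg _) (pow_le_one₀ hs0 hs1)
      refine (add_le_add h1 h2).trans ?_
      -- Both odd powers are absorbed by squares, so the fourth moment suffices. The expectation of
      -- the right side is at most `5/2 + M/2 ≤ 3 M`.
      have h3 : |a| * a ^ 2 + (|a| + a ^ 2) ≤ 1 / 2 + 2 * a ^ 2 + 1 / 2 * a ^ 4 := by
        have e : a ^ 4 = (|a| ^ 2) ^ 2 := by rw [sq_abs]; ring
        rw [e, ← sq_abs a]
        nlinarith [sq_nonneg (|a| - 1), sq_nonneg (|a| ^ 2 - |a|)]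
      nlinarith
    have hI : Integrable (fun a => D * (1 / 2 + 2 * a ^ 2 + 1 / 2 * a ^ 4)) μ :=
      (((integrable_const _).add (i2.const_mul 2)).add (i4.const_mul _)).const_mul D
    refine ⟨hI.mono' (by fun_prop) (Filter.Eventually.of_forall hb), ?_⟩
    refine (norm_integral_le_of_norm_le hI (Filter.Eventually.of_forall hb)).trans ?_
    rw [integral_const_mul, integral_add ((integrable_const _).fun_add (i2.const_mul 2))
      (i4.const_mul _), integral_add (integrable_const _) (i2.const_mul 2), integral_const_mul,
      integral_const_mul, hμ.second]
    simp only [integral_const, probReal_univ, smul_eq_mul, one_mul]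
    nlinarith [hμ.one_le, hμ.fourth]
  have hsplit : ∫ a, (a * k (s * a) - s * k' (s * a)) ∂μ =
      ∫ a, (a * (k (s * a) - k 0 - s * a * k' 0) - s * (k' (s * a) - k' 0)) ∂μ := by
    -- The first-order Taylor parts contribute exactly this expression, which vanishes by the
    -- matching of mean and variance.
    have h1 : ∫ a, (k 0 * a + s * k' 0 * (a ^ 2 - 1)) ∂μ = 0 := by
      rw [integral_add (i1.const_mul _) (i21.const_mul _),
        integral_const_mul, integral_const_mul, integral_sub i2 (integrable_const _), hμ.mean,
        hμ.second]
      simp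
    have h2 := integral_add hi1.1
      ((i1.const_mul (k 0)).fun_add (i21.const_mul (s * k' 0)))
    rw [h1, add_zero] at h2
    rw [← h2]
    congr 1; ext a; ring
  rw [hsplit]
  refine hi1.2.trans (le_of_eq ?_)
  rw [hD]; ring

/-! ### Second moments of linear and quadratic forms in independent variables. -/

section product
variable {ι : Type*} [Fintype ι] [DecidableEq ι] {μ : ι → Measure ℝ}
  [∀ i, IsProbabilityMeasure (μ i)] {M : ℝ}

/-- Factorization of an expectation over one independent coordinate. -/
theorem integral_comp_eval_mul (i : ι) {φ : ℝ → ℝ} {G : (ι → ℝ) → ℝ}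
    (hG : ∀ x a, G (Function.update x i a) = G x)
    (hint : Integrable (fun x => φ (x i) * G x) (Measure.pi μ)) :
    ∫ x, φ (x i) * G x ∂Measure.pi μ = (∫ a, φ a ∂μ i) * ∫ x, G x ∂Measure.pi μ := by
  rw [integral_pi_eq_integral_update μ i hint]
  simp only [Function.update_self, hG, integral_mul_const, integral_const_mul]

theorem integral_comp_eval (i : ι) {φ : ℝ → ℝ} (hφ : Integrable φ (μ i)) :
    ∫ x, φ (x i) ∂Measure.pi μ = ∫ a, φ a ∂μ i := by
  have := integral_comp_eval_mul (μ := μ) i (φ := φ) (G := fun _ => 1) (fun _ _ => rfl)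
    (by simpa using integrable_comp_eval hφ)
  simpa using this

theorem memLp_eval_pi (hμ : ∀ i, HasNormalizedMoments (μ i) M) (i : ι) :
    MemLp (fun x : ι → ℝ => x i) 4 (Measure.pi μ) :=
  (hμ i).memLp.comp_measurePreserving (measurePreserving_eval μ i)

theorem memLp_two_eval_pi (hμ : ∀ i, HasNormalizedMoments (μ i) M) (i : ι) :
    MemLp (fun x : ι → ℝ => x i) 2 (Measure.pi μ) :=
  (memLp_eval_pi hμ i).mono_exponent (by norm_num)

theorem integral_eval_sq_pi (hμ : ∀ i, HasNormalizedMoments (μ i) M) (i : ι) :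
    ∫ x, x i ^ 2 ∂Measure.pi μ = 1 := by
  rw [integral_comp_eval i (φ := fun a => a ^ 2) (hμ i).integrable_two, (hμ i).second]

theorem integral_eval_mul_eval_pi (hμ : ∀ i, HasNormalizedMoments (μ i) M) (i j : ι) :
    ∫ x, x i * x j ∂Measure.pi μ = if i = j then 1 else 0 := by
  split_ifs with h
  · subst h
    simpa [sq] using integral_eval_sq_pi hμ i
  · have := integral_comp_eval_mul (μ := μ) i (φ := fun a => a) (G := fun x => x j)
      (fun x a => by rw [Function.update_of_ne (Ne.symm h)])
      ((memLp_two_eval_pi hμ i).integrable_mul (memLp_two_eval_pi hμ j))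
    rw [this, (hμ i).mean, zero_mul]

theorem integral_sum_mul_eval_sq (hμ : ∀ i, HasNormalizedMoments (μ i) M) (b : ι → ℝ) :
    ∫ x, (∑ j, b j * x j) ^ 2 ∂Measure.pi μ = ∑ j, b j ^ 2 := by
  have h1 : ∀ x : ι → ℝ, (∑ j, b j * x j) ^ 2 = ∑ i, ∑ j, b i * b j * (x i * x j) := fun x => by
    rw [sq, Finset.sum_mul_sum]
    exact Finset.sum_congr rfl fun i _ => Finset.sum_congr rfl fun j _ => by ring
  simp only [h1]
  have hi : ∀ i j, Integrable (fun x : ι → ℝ => b i * b j * (x i * x j)) (Measure.pi μ) :=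
    fun i j => ((memLp_two_eval_pi hμ i).integrable_mul (memLp_two_eval_pi hμ j)).const_mul _
  rw [integral_finsetSum _ fun i _ => integrable_finsetSum _ fun j _ => hi i j]
  refine Finset.sum_congr rfl fun i _ => ?_
  rw [integral_finsetSum _ fun j _ => hi i j]
  simp [integral_const_mul, integral_eval_mul_eval_pi hμ, sq]

theorem memLp_eval_mul_eval_pi (hμ : ∀ i, HasNormalizedMoments (μ i) M) (i j : ι) :
    MemLp (fun x : ι → ℝ => x i * x j) 2 (Measure.pi μ) := by
  have : ENNReal.HolderTriple 4 4 2 := ⟨by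
    rw [← ENNReal.toReal_eq_toReal_iff' (by simp) (by simp)]
    rw [ENNReal.toReal_add (by simp) (by simp)]
    simp; norm_num⟩
  exact (memLp_eval_pi hμ j).mul (memLp_eval_pi hμ i)

/-- If the pairs differ as sets, some index occurs exactly once and its zero mean kills the
expectation. -/
theorem integral_eval_mul_four_pi (hμ : ∀ i, HasNormalizedMoments (μ i) M) {i j k l : ι}
    (hij : i ≠ j) (hkl : k ≠ l) :
    ∫ x, (x i * x j) * (x k * x l) ∂Measure.pi μ =
      (if k = i ∧ l = j then 1 else 0) + if k = j ∧ l = i then 1 else 0 := by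
  have hint := (memLp_eval_mul_eval_pi hμ i j).integrable_mul (memLp_eval_mul_eval_pi hμ k l)
  have hpair : ∀ i j : ι, i ≠ j → ∫ x, (x i * x j) * (x i * x j) ∂Measure.pi μ = 1 := by
    intro i j hij
    have h1 := (memLp_eval_mul_eval_pi hμ i j).integrable_mul (memLp_eval_mul_eval_pi hμ i j)
    have h2 := integral_comp_eval_mul (μ := μ) i (φ := fun a => a ^ 2) (G := fun x => x j ^ 2)
      (fun x a => by rw [Function.update_of_ne hij.symm])
      (h1.congr (Filter.Eventually.of_forall fun x => by simp only [Pi.mul_apply]; ring))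
    rw [(hμ i).second, integral_eval_sq_pi hμ, one_mul] at h2
    rw [← h2]
    congr 1; ext x; ring
  have hone : ∀ i j k l : ι, i ≠ j → i ≠ k → i ≠ l →
      ∫ x, (x i * x j) * (x k * x l) ∂Measure.pi μ = 0 := by
    intro i j k l h1 h2 h3
    have hint := (memLp_eval_mul_eval_pi hμ i j).integrable_mul (memLp_eval_mul_eval_pi hμ k l)
    have h4 := integral_comp_eval_mul (μ := μ) i (φ := fun a => a)
      (G := fun x => x j * (x k * x l))
      (fun x a => by
        rw [Function.update_of_ne h1.symm, Function.update_of_ne h2.symm,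
          Function.update_of_ne h3.symm])
      (hint.congr (Filter.Eventually.of_forall fun x => by simp only [Pi.mul_apply]; ring))
    rw [(hμ i).mean, zero_mul] at h4
    rw [← h4]
    congr 1; ext x; ring
  by_cases hik : i = k
  · subst hik
    by_cases hjl : j = l
    · subst hjl
      rw [hpair i j hij]
      simp [hij]
    · have h1 := hone j i i l hij.symm hij.symm hjl
      have e : ∀ x : ι → ℝ, x i * x j * (x i * x l) = x j * x i * (x i * x l) := fun x => by ring
      simp only [e, h1]
      simp [Ne.symm hjl, hij]
  · by_cases hil : i = l
    · subst hil
      by_cases hjk : j = k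
      · subst hjk
        have h1 := hpair i j hij
        have e : ∀ x : ι → ℝ, x i * x j * (x j * x i) = x i * x j * (x i * x j) :=
          fun x => by ring
        simp only [e, h1]
        simp [hij, hij.symm]
      · have h1 := hone j i k i hij.symm hjk hij.symm
        have e : ∀ x : ι → ℝ, x i * x j * (x k * x i) = x j * x i * (x k * x i) :=
          fun x => by ring
        simp only [e, h1]
        simp [Ne.symm hik, Ne.symm hjk]
    · rw [hone i j k l hij hik hil]
      simp [Ne.symm hik, Ne.symm hil]

/-- The factor 2 counts each ordered pair together with its swap. -/
theorem integral_offDiag_sq (hμ : ∀ i, HasNormalizedMoments (μ i) M) {f : ι → ι → ℝ}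
    (hf : ∀ i j, f i j = f j i) :
    ∫ x, (∑ q ∈ (Finset.univ : Finset ι).offDiag, f q.1 q.2 * (x q.1 * x q.2)) ^ 2
      ∂Measure.pi μ = 2 * ∑ q ∈ (Finset.univ : Finset ι).offDiag, f q.1 q.2 ^ 2 := by
  set S := (Finset.univ : Finset ι).offDiag
  have h1 : ∀ x : ι → ℝ, (∑ q ∈ S, f q.1 q.2 * (x q.1 * x q.2)) ^ 2 = ∑ q ∈ S, ∑ r ∈ S,
      f q.1 q.2 * f r.1 r.2 * ((x q.1 * x q.2) * (x r.1 * x r.2)) := fun x => by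
    rw [sq, Finset.sum_mul_sum]
    exact Finset.sum_congr rfl fun i _ => Finset.sum_congr rfl fun j _ => by ring
  simp only [h1]
  have hi : ∀ q r : ι × ι, Integrable (fun x : ι → ℝ =>
      f q.1 q.2 * f r.1 r.2 * ((x q.1 * x q.2) * (x r.1 * x r.2))) (Measure.pi μ) := fun q r =>
    ((memLp_eval_mul_eval_pi hμ q.1 q.2).integrable_mul
      (memLp_eval_mul_eval_pi hμ r.1 r.2)).const_mul _
  rw [integral_finsetSum _ fun i _ => integrable_finsetSum _ fun j _ => hi i j, Finset.mul_sum]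
  refine Finset.sum_congr rfl fun q hq => ?_
  rw [integral_finsetSum _ fun j _ => hi q j]
  have hq' : q.1 ≠ q.2 := (Finset.mem_offDiag.1 hq).2.2
  have h2 : ∀ r ∈ S, ∫ x, f q.1 q.2 * f r.1 r.2 * ((x q.1 * x q.2) * (x r.1 * x r.2))
      ∂Measure.pi μ = (if r = q then f q.1 q.2 * f r.1 r.2 else 0) +
        if r = q.swap then f q.1 q.2 * f r.1 r.2 else 0 := by
    intro r hr
    rw [integral_const_mul, integral_eval_mul_four_pi hμ hq' (Finset.mem_offDiag.1 hr).2.2]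
    simp only [Prod.ext_iff, Prod.fst_swap, Prod.snd_swap]
    split_ifs <;> ring
  rw [Finset.sum_congr rfl h2, Finset.sum_add_distrib, Finset.sum_ite_eq', Finset.sum_ite_eq',
    if_pos hq, if_pos (Finset.mem_offDiag.2 ⟨Finset.mem_univ _, Finset.mem_univ _, hq'.symm⟩)]
  simp only [Prod.fst_swap, Prod.snd_swap, hf q.2 q.1]
  ring

theorem memLp_eval_sq_sub_one (hμ : ∀ i, HasNormalizedMoments (μ i) M) (i : ι) :
    MemLp (fun x : ι → ℝ => x i ^ 2 - 1) 2 (Measure.pi μ) := by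
  have := memLp_eval_mul_eval_pi hμ i i
  simp only [← sq] at this
  exact this.sub (memLp_const 1)

/-- The variables `x i ^ 2 - 1` are independent and centered, with variance at most `M - 1`. -/
theorem integral_diag_sq_le (hμ : ∀ i, HasNormalizedMoments (μ i) M) (b : ι → ℝ) :
    ∫ x, (∑ i, b i * (x i ^ 2 - 1)) ^ 2 ∂Measure.pi μ ≤ M * ∑ i, b i ^ 2 := by
  have h1 : ∀ x : ι → ℝ, (∑ i, b i * (x i ^ 2 - 1)) ^ 2 = ∑ i, ∑ j,
      b i * b j * ((x i ^ 2 - 1) * (x j ^ 2 - 1)) := fun x => by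
    rw [sq, Finset.sum_mul_sum]
    exact Finset.sum_congr rfl fun i _ => Finset.sum_congr rfl fun j _ => by ring
  simp only [h1]
  have hint : ∀ i j, Integrable (fun x : ι → ℝ => (x i ^ 2 - 1) * (x j ^ 2 - 1)) (Measure.pi μ) :=
    fun i j => (memLp_eval_sq_sub_one hμ i).integrable_mul (memLp_eval_sq_sub_one hμ j)
  rw [integral_finsetSum _ fun i _ => integrable_finsetSum _ fun j _ => (hint i j).const_mul _,
    Finset.mul_sum]
  refine Finset.sum_le_sum fun i _ => ?_
  rw [integral_finsetSum _ fun j _ => (hint i j).const_mul _,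
    Finset.sum_eq_single i _ (by simp)]
  · rw [integral_const_mul, mul_comm M, ← sq (b i)]
    refine mul_le_mul_of_nonneg_left ?_ (sq_nonneg _)
    have i2 := (hμ i).integrable_two
    have i4 := (hμ i).integrable_four
    rw [integral_comp_eval i (φ := fun a => (a ^ 2 - 1) * (a ^ 2 - 1))]
    · have e : ∀ a : ℝ, (a ^ 2 - 1) * (a ^ 2 - 1) = a ^ 4 + ((-2) * a ^ 2 + 1) := fun a => by ring
      simp only [e]
      rw [integral_add i4 ((i2.const_mul _).fun_add (integrable_const _)),
        integral_add (i2.const_mul _) (integrable_const _), integral_const_mul, (hμ i).second]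
      simp
      linarith [(hμ i).fourth]
    · refine (i4.fun_add ((i2.const_mul (-2)).fun_add (integrable_const 1))).congr
        (Filter.Eventually.of_forall fun a => ?_)
      simp only; ring
  · intro j _ hj
    rw [integral_const_mul, integral_comp_eval_mul i (φ := fun a => a ^ 2 - 1)
      (G := fun x => x j ^ 2 - 1) (fun x a => by rw [Function.update_of_ne hj]) (hint i j),
      integral_sub (hμ i).integrable_two (integrable_const _), (hμ i).second]
    simp

theorem memLp_offDiag (hμ : ∀ i, HasNormalizedMoments (μ i) M) (f : ι → ι → ℝ) :
    MemLp (fun x : ι → ℝ => ∑ q ∈ (Finset.univ : Finset ι).offDiag,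
      f q.1 q.2 * (x q.1 * x q.2)) 2 (Measure.pi μ) :=
  memLp_finsetSum _ fun q _ => (memLp_eval_mul_eval_pi hμ q.1 q.2).const_mul _

theorem memLp_diag (hμ : ∀ i, HasNormalizedMoments (μ i) M) (b : ι → ℝ) :
    MemLp (fun x : ι → ℝ => ∑ i, b i * (x i ^ 2 - 1)) 2 (Measure.pi μ) :=
  memLp_finsetSum _ fun i _ => (memLp_eval_sq_sub_one hμ i).const_mul _

theorem sum_sum_eq_offDiag_add_diag (F : ι → ι → ℝ) :
    ∑ i, ∑ j, F i j = ∑ q ∈ (Finset.univ : Finset ι).offDiag, F q.1 q.2 + ∑ i, F i i := by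
  rw [← Finset.sum_product', ← Finset.diag_union_offDiag,
    Finset.sum_union (Finset.disjoint_diag_offDiag _), add_comm, Finset.sum_diag]

/-- The centered quadratic form of a symmetric matrix is bounded in mean square by its
Hilbert-Schmidt norm. -/
theorem integral_centered_form_sq_le (hμ : ∀ i, HasNormalizedMoments (μ i) M)
    {f : ι → ι → ℝ} (hf : ∀ i j, f i j = f j i) :
    MemLp (fun x : ι → ℝ => kernelForm f x - ∑ i, f i i) 2 (Measure.pi μ) ∧
    ∫ x, (kernelForm f x - ∑ i, f i i) ^ 2 ∂Measure.pi μ ≤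
      (4 + 2 * M) * ∑ i, ∑ j, f i j ^ 2 := by
  -- Without any index the moment conditions say nothing about `M`, but both sides then vanish.
  have hM : 0 ≤ M ∨ IsEmpty ι := by
    rcases isEmpty_or_nonempty ι with h | ⟨⟨i⟩⟩
    · exact Or.inr h
    · exact Or.inl (zero_le_one.trans (hμ i).one_le)
  have e : ∀ x : ι → ℝ, kernelForm f x - ∑ i, f i i =
      ∑ q ∈ (Finset.univ : Finset ι).offDiag, f q.1 q.2 * (x q.1 * x q.2) +
        ∑ i, f i i * (x i ^ 2 - 1) := fun x => by
    have h1 : kernelForm f x = ∑ i, ∑ j, f i j * (x i * x j) := by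
      unfold kernelForm kernelCoord
      refine Finset.sum_congr rfl fun i _ => ?_
      rw [Finset.mul_sum]
      exact Finset.sum_congr rfl fun j _ => by ring
    rw [h1, sum_sum_eq_offDiag_add_diag, add_sub_assoc, ← Finset.sum_sub_distrib]
    congr 1
    exact Finset.sum_congr rfl fun i _ => by ring
  simp only [e]
  have m1 := memLp_offDiag hμ f
  have m2 := memLp_diag hμ fun i => f i i
  refine ⟨m1.add m2, ?_⟩
  calc ∫ x, (∑ q ∈ (Finset.univ : Finset ι).offDiag, f q.1 q.2 * (x q.1 * x q.2) +
        ∑ i, f i i * (x i ^ 2 - 1)) ^ 2 ∂Measure.pi μ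
      ≤ ∫ x, (2 * (∑ q ∈ (Finset.univ : Finset ι).offDiag, f q.1 q.2 * (x q.1 * x q.2)) ^ 2 +
        2 * (∑ i, f i i * (x i ^ 2 - 1)) ^ 2) ∂Measure.pi μ := by
        refine integral_mono (m1.add m2).integrable_sq
          ((m1.integrable_sq.const_mul 2).add (m2.integrable_sq.const_mul 2)) fun x => ?_
        simp only
        nlinarith [sq_nonneg ((∑ q ∈ (Finset.univ : Finset ι).offDiag,
          f q.1 q.2 * (x q.1 * x q.2)) - ∑ i, f i i * (x i ^ 2 - 1))]
    _ ≤ 4 * ∑ q ∈ (Finset.univ : Finset ι).offDiag, f q.1 q.2 ^ 2 +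
        2 * M * ∑ i, f i i ^ 2 := by
        rw [integral_add (m1.integrable_sq.const_mul 2) (m2.integrable_sq.const_mul 2),
          integral_const_mul, integral_const_mul, integral_offDiag_sq hμ hf]
        have := integral_diag_sq_le hμ fun i => f i i
        linarith
    _ ≤ (4 + 2 * M) * ∑ i, ∑ j, f i j ^ 2 := by
        rw [sum_sum_eq_offDiag_add_diag fun i j => f i j ^ 2]
        have h1 : 0 ≤ ∑ q ∈ (Finset.univ : Finset ι).offDiag, f q.1 q.2 ^ 2 :=
          Finset.sum_nonneg fun _ _ => sq_nonneg _
        have h2 : 0 ≤ ∑ i, f i i ^ 2 := Finset.sum_nonneg fun _ _ => sq_nonneg _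
        rcases hM with h | h
        · have := mul_nonneg h h1
          nlinarith
        · simp [Finset.univ_eq_empty]

end product

/-! ### Interpolation between the given variables and Gaussian ones. -/

section interpolation
variable {ι : Type*} [Fintype ι] [DecidableEq ι] {μ : ι → Measure ℝ}
  [∀ i, IsProbabilityMeasure (μ i)] {M : ℝ} {p : ι → ι → ℝ} {h h₁ h₂ h₃ : ℝ → ℝ} {B : ℝ}

/-- Suppressing the `i`-th variable only removes the term `p i i ^ 2` from `∑ j, p i j ^ 2 = p i i`.
-/
theorem integral_kernelCoord_update_sq_le (hμ : ∀ i, HasNormalizedMoments (μ i) M)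
    (hp : IsProjKernel p) (i : ι) :
    Integrable (fun x => kernelCoord p i (Function.update x i 0) ^ 2) (Measure.pi μ) ∧
    ∫ x, kernelCoord p i (Function.update x i 0) ^ 2 ∂Measure.pi μ ≤ p i i := by
  have e : ∀ x : ι → ℝ, kernelCoord p i (Function.update x i 0) =
      ∑ j, (if j = i then 0 else p i j) * x j := fun x => by
    unfold kernelCoord
    refine Finset.sum_congr rfl fun j _ => ?_
    by_cases hj : j = i
    · subst hj; simp
    · simp [hj]
  simp only [e]
  refine ⟨?_, ?_⟩
  · exact (memLp_finsetSum _ fun j _ => (memLp_two_eval_pi hμ j).const_mul _).integrable_sq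
  · rw [integral_sum_mul_eval_sq hμ, ← hp.sum_sq i]
    refine Finset.sum_le_sum fun j _ => ?_
    split_ifs
    · simpa using sq_nonneg (p i j)
    · exact le_rfl

theorem smul_update_eq (x : ι → ℝ) (i : ι) (s a : ℝ) :
    s • Function.update x i a =
      s • Function.update x i 0 + (Pi.single i (s * a) : ι → ℝ) := by
  ext k
  by_cases hk : k = i
  · subst hk; simp
  · simp [Function.update_of_ne hk, Pi.single_eq_of_ne hk]

/-- The Lindeberg error in one coordinate. -/
theorem abs_integral_resample_le (hμ : ∀ i, HasNormalizedMoments (μ i) M)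
    (hp : IsProjKernel p) (H : IsSmoothTest h h₁ h₂ h₃ B) {s c : ℝ} (hs0 : 0 ≤ s) (hs1 : s ≤ 1)
    (hc0 : 0 < c) (hc1 : c ≤ 1) (i : ι)
    (hint : Integrable (fun x : ι → ℝ => c * x i * gaussianSmooth c (formGrad p h₁ i) (s • x) -
      s * (c * gaussianSmooth c (formHess p h₁ h₂ i) (s • x))) (Measure.pi μ)) :
    |∫ x, (c * x i * gaussianSmooth c (formGrad p h₁ i) (s • x) -
      s * (c * gaussianSmooth c (formHess p h₁ h₂ i) (s • x))) ∂Measure.pi μ| ≤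
        324 * M * √(p i i) ^ 3 := by
  set τ := √(p i i) with hτ
  have hp0 := hp.diag_nonneg i
  have hτ2 : τ ^ 2 = p i i := Real.sq_sqrt hp0
  have hM := (hμ i).one_le
  rw [integral_pi_eq_integral_update μ i hint]
  simp only [Function.update_self]
  obtain ⟨hI, hle⟩ := integral_kernelCoord_update_sq_le hμ hp i
  have key : ∀ x : ι → ℝ, ‖∫ a, (c * a * gaussianSmooth c (formGrad p h₁ i)
      (s • Function.update x i a) - s * (c * gaussianSmooth c (formHess p h₁ h₂ i)
      (s • Function.update x i a))) ∂μ i‖ ≤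
      162 * M * τ * (p i i + kernelCoord p i (Function.update x i 0) ^ 2) := by
    intro x
    -- The base point `b` omits the `i`-th variable, so the inner integral over `a` is a
    -- one-dimensional Stein discrepancy along the `i`-th axis.
    obtain ⟨b, hb⟩ : ∃ b, b = s • Function.update x i 0 := ⟨_, rfl⟩
    have hbu : ∀ a : ℝ, s • Function.update x i a = b + (Pi.single i (s * a) : ι → ℝ) :=
      fun a => hb ▸ smul_update_eq x i s a
    simp only [hbu]
    have hA : ∀ u : ℝ, kernelCoord p i (b + (Pi.single i u : ι → ℝ)) =
        kernelCoord p i b + u * τ ^ 2 := fun u => by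
      rw [kernelCoord_add, kernelCoord_single, hτ2]
    have h1 := abs_integral_mul_sub_deriv_le (A := kernelCoord p i b) (τ := τ) (K := 1 / c)
      (Real.sqrt_nonneg _) (Real.sqrt_le_one.2 (hp.diag_le_one i))
      ((one_le_div hc0).2 hc1) hs0 hs1
      (hasDerivAt_gaussianSmooth_formGrad hp H b c i)
      (hasDerivAt_gaussianSmooth_formHess hp H b c i)
      (fun u => by
        rw [← hA]
        exact abs_gaussianSmooth_formGrad_le hp H _ hc0.le hc1 i)
      (fun u => by
        rw [← hA, hτ2]
        exact abs_gaussianSmooth_formHess_le hp H _ hc0.le hc1 i)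
      (fun u => by
        rw [← hA, hτ2, mul_one_div]
        exact abs_gaussianSmooth_formThird_le hp H _ hc0 hc1 i) (hμ i)
    have h2 : ∀ a : ℝ, c * a * gaussianSmooth c (formGrad p h₁ i)
        (b + (Pi.single i (s * a) : ι → ℝ)) - s * (c * gaussianSmooth c (formHess p h₁ h₂ i)
        (b + (Pi.single i (s * a) : ι → ℝ))) = c * (a * gaussianSmooth c (formGrad p h₁ i)
        (b + (Pi.single i (s * a) : ι → ℝ)) - s * gaussianSmooth c (formHess p h₁ h₂ i)
        (b + (Pi.single i (s * a) : ι → ℝ))) := fun a => by ring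
    simp only [h2]
    rw [integral_const_mul, Real.norm_eq_abs, abs_mul, abs_of_pos hc0]
    refine (mul_le_mul_of_nonneg_left h1 hc0.le).trans ?_
    rw [hτ2, hb, kernelCoord_smul]
    have h3 : (s * kernelCoord p i (Function.update x i 0)) ^ 2 ≤
        kernelCoord p i (Function.update x i 0) ^ 2 := by
      rw [mul_pow]
      exact mul_le_of_le_one_left (sq_nonneg _) (pow_le_one₀ hs0 hs1)
    -- The outer factor `c` cancels the `1 / c` paid for removing the third derivative.
    have h4 : c * (162 * (1 / c) * M * τ * (p i i + (s * kernelCoord p i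
        (Function.update x i 0)) ^ 2)) = 162 * M * τ * (p i i + (s * kernelCoord p i
        (Function.update x i 0)) ^ 2) := by
      field_simp
    rw [h4]
    gcongr
  refine (norm_integral_le_of_norm_le (((integrable_const _).fun_add hI).const_mul _)
    (Filter.Eventually.of_forall key)).trans ?_
  rw [integral_const_mul, integral_add (integrable_const _) hI]
  simp only [integral_const, probReal_univ, smul_eq_mul, one_mul]
  have h5 : p i i + ∫ x, kernelCoord p i (Function.update x i 0) ^ 2 ∂Measure.pi μ ≤
      2 * τ ^ 2 := by rw [hτ2]; linarith
  calc _ ≤ 162 * M * τ * (2 * τ ^ 2) := by gcongr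
    _ = _ := by ring

/-- Makes every moment estimate for product measures available for the Gaussian vector too. -/
theorem normalizedMoments_gaussianReal : HasNormalizedMoments (gaussianReal 0 1) 3 where
  memLp := memLp_id_gaussianReal' 4 (by simp)
  mean := integral_id_gaussianReal
  second := by
    have := integral_id_mul_gaussianReal (F := fun x => x) (F' := fun _ => 1)
      (fun x => hasDerivAt_id x) PolyGrowth.id_real.integrable_gaussianReal
      (PolyGrowth.id_real.mul PolyGrowth.id_real).integrable_gaussianReal
      (integrable_const _)
    simpa [sq] using this
  fourth := by
    have h2 := integral_id_mul_gaussianReal (F := fun x => x) (F' := fun _ => 1)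
      (fun x => hasDerivAt_id x) PolyGrowth.id_real.integrable_gaussianReal
      (PolyGrowth.id_real.mul PolyGrowth.id_real).integrable_gaussianReal
      (integrable_const _)
    have h4 := integral_id_mul_gaussianReal (F := fun x => x ^ 3) (F' := fun x => 3 * x ^ 2)
      (fun x => by simpa using hasDerivAt_pow 3 x)
      (PolyGrowth.id_real.pow 3).integrable_gaussianReal
      (PolyGrowth.id_real.mul (PolyGrowth.id_real.pow 3)).integrable_gaussianReal
      ((PolyGrowth.id_real.pow 2).const_mul 3).integrable_gaussianReal
    rw [integral_const_mul] at h4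
    have e : ∀ x : ℝ, x ^ 4 = x * x ^ 3 := fun x => by ring
    simp only [e, h4]
    simp only [sq, h2]
    simp

/-- Square integrability of a linear functional of both components of a pair. -/
theorem memLp_fst_snd (hμ : ∀ i, HasNormalizedMoments (μ i) M) (i : ι) :
    MemLp (fun z : (ι → ℝ) × (ι → ℝ) => z.1 i) 2 ((Measure.pi μ).prod (gaussianPi ι)) ∧
    MemLp (fun z : (ι → ℝ) × (ι → ℝ) => z.2 i) 2 ((Measure.pi μ).prod (gaussianPi ι)) :=
  ⟨(memLp_two_eval_pi hμ i).comp_measurePreserving measurePreserving_fst,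
    (memLp_two_eval_pi (fun _ => normalizedMoments_gaussianReal) i).comp_measurePreserving
      measurePreserving_snd⟩

theorem IsSmoothTest.abs_le (H : IsSmoothTest h h₁ h₂ h₃ B) (v : ℝ) : |h v| ≤ |h 0| + |v| := by
  have h1 := abs_sub_le_of_hasDerivAt H.deriv₁ (u := v) (L := 1) fun w _ => H.bound₁ w
  have := abs_sub_abs_le_abs_sub (h v) (h 0)
  linarith

theorem integrable_comp_kernelForm {Ω : Type*} [MeasurableSpace Ω] {P : Measure Ω}
    [IsProbabilityMeasure P] (H : IsSmoothTest h h₁ h₂ h₃ B) {Z : Ω → ι → ℝ}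
    (hZm : Measurable Z) (hZ : ∀ i, MemLp (fun ω => Z ω i) 2 P) :
    Integrable (fun ω => h (kernelForm p (Z ω))) P := by
  have h1 : Integrable (fun ω => kernelForm p (Z ω)) P := by
    unfold kernelForm kernelCoord
    exact integrable_finsetSum _ fun i _ => (hZ i).integrable_mul
      (memLp_finsetSum _ fun j _ => (hZ j).const_mul _)
  refine ((integrable_const (|h 0|)).fun_add h1.norm).mono'
    (H.measurable₀.comp (measurable_kernelForm.comp hZm)).aestronglyMeasurable
    (Filter.Eventually.of_forall fun ω => ?_)
  exact H.abs_le _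

/-- The Gaussian interpolation and its derivative. -/
theorem hasDerivAt_interpolation (hμ : ∀ i, HasNormalizedMoments (μ i) M)
    (hp : IsProjKernel p) (H : IsSmoothTest h h₁ h₂ h₃ B) (θ : ℝ) :
    HasDerivAt (fun θ => ∫ z : (ι → ℝ) × (ι → ℝ),
        h (kernelForm p (Real.sin θ • z.1 + Real.cos θ • z.2))
        ∂((Measure.pi μ).prod (gaussianPi ι)))
      (∑ i, ∫ z : (ι → ℝ) × (ι → ℝ), (Real.cos θ * z.1 i - Real.sin θ * z.2 i) *
        formGrad p h₁ i (Real.sin θ • z.1 + Real.cos θ • z.2)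
        ∂((Measure.pi μ).prod (gaussianPi ι))) θ ∧
    ∀ i, Integrable (fun z : (ι → ℝ) × (ι → ℝ) => (Real.cos θ * z.1 i - Real.sin θ * z.2 i) *
        formGrad p h₁ i (Real.sin θ • z.1 + Real.cos θ • z.2))
        ((Measure.pi μ).prod (gaussianPi ι)) := by
  have hZm : ∀ θ : ℝ, Measurable fun z : (ι → ℝ) × (ι → ℝ) =>
      Real.sin θ • z.1 + Real.cos θ • z.2 := fun θ => by fun_prop
  have hZL : ∀ (θ : ℝ) i, MemLp (fun z : (ι → ℝ) × (ι → ℝ) =>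
      (Real.sin θ • z.1 + Real.cos θ • z.2) i) 2 ((Measure.pi μ).prod (gaussianPi ι)) :=
    fun θ i => ((memLp_fst_snd hμ i).1.const_mul _).add ((memLp_fst_snd hμ i).2.const_mul _)
  have hmeas : ∀ (θ : ℝ) i, Measurable fun z : (ι → ℝ) × (ι → ℝ) =>
      (Real.cos θ * z.1 i - Real.sin θ * z.2 i) *
        formGrad p h₁ i (Real.sin θ • z.1 + Real.cos θ • z.2) := fun θ i =>
    Measurable.mul (by fun_prop) ((measurable_formGrad H i).comp (hZm θ))
  -- A dominating function uniform in `θ`, using only `|sin θ| ≤ 1` and `|cos θ| ≤ 1`.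
  set R : ι → (ι → ℝ) × (ι → ℝ) → ℝ := fun i z => (|z.1 i| + |z.2 i|) *
    (2 * (|kernelCoord p i z.1| + |kernelCoord p i z.2|)) with hR
  have hRi : ∀ i, Integrable (R i) ((Measure.pi μ).prod (gaussianPi ι)) := fun i => by
    have k1 : MemLp (fun z : (ι → ℝ) × (ι → ℝ) => kernelCoord p i z.1) 2
        ((Measure.pi μ).prod (gaussianPi ι)) :=
      memLp_finsetSum _ fun j _ => (memLp_fst_snd hμ j).1.const_mul (p i j)
    have k2 : MemLp (fun z : (ι → ℝ) × (ι → ℝ) => kernelCoord p i z.2) 2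
        ((Measure.pi μ).prod (gaussianPi ι)) :=
      memLp_finsetSum _ fun j _ => (memLp_fst_snd hμ j).2.const_mul (p i j)
    have k3 := (memLp_fst_snd hμ i).1.norm.add (memLp_fst_snd hμ i).2.norm
    have k4 := (k1.norm.add k2.norm).const_mul 2
    exact k3.integrable_mul k4
  have hbound : ∀ (θ : ℝ) i z, ‖(Real.cos θ * z.1 i - Real.sin θ * z.2 i) *
        formGrad p h₁ i (Real.sin θ • z.1 + Real.cos θ • z.2)‖ ≤ R i z := fun θ i z => by
    have hs := Real.abs_sin_le_one θ
    have hc := Real.abs_cos_le_one θ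
    rw [norm_mul, hR]
    refine mul_le_mul ?_ ((abs_formGrad_le H i _).trans (mul_le_mul_of_nonneg_left ?_ two_pos.le))
      (norm_nonneg _) (by positivity)
    · refine (abs_sub _ _).trans ?_
      rw [abs_mul, abs_mul]
      exact add_le_add (mul_le_of_le_one_left (abs_nonneg _) hc)
        (mul_le_of_le_one_left (abs_nonneg _) hs)
    · rw [kernelCoord_add, kernelCoord_smul, kernelCoord_smul]
      refine (abs_add_le _ _).trans ?_
      rw [abs_mul, abs_mul]
      exact add_le_add (mul_le_of_le_one_left (abs_nonneg _) hs)
        (mul_le_of_le_one_left (abs_nonneg _) hc)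
  have hI : ∀ (θ : ℝ) i, Integrable (fun z : (ι → ℝ) × (ι → ℝ) =>
      (Real.cos θ * z.1 i - Real.sin θ * z.2 i) *
        formGrad p h₁ i (Real.sin θ • z.1 + Real.cos θ • z.2))
        ((Measure.pi μ).prod (gaussianPi ι)) := fun θ i =>
    (hRi i).mono' (hmeas θ i).aestronglyMeasurable (Filter.Eventually.of_forall (hbound θ i))
  refine ⟨?_, hI θ⟩
  rw [← integral_finsetSum _ fun i _ => hI θ i]
  refine (hasDerivAt_integral_of_dominated_loc_of_deriv_le (Metric.ball_mem_nhds θ one_pos)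
    (bound := fun z => ∑ i, R i z) (F' := fun θ z => ∑ i,
      (Real.cos θ * z.1 i - Real.sin θ * z.2 i) *
        formGrad p h₁ i (Real.sin θ • z.1 + Real.cos θ • z.2))
    (Filter.Eventually.of_forall fun θ =>
      (H.measurable₀.comp (measurable_kernelForm.comp (hZm θ))).aestronglyMeasurable)
    (integrable_comp_kernelForm H (hZm θ) (hZL θ))
    (Finset.measurable_sum _ fun i _ => hmeas θ i).aestronglyMeasurable
    (Filter.Eventually.of_forall fun z θ _ =>
      (norm_sum_le _ _).trans (Finset.sum_le_sum fun i _ => hbound θ i z))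
    (integrable_finsetSum _ fun i _ => hRi i)
    (Filter.Eventually.of_forall fun z θ _ => ?_)).2
  have h1 := (H.deriv₁ _).comp θ (hasDerivAt_kernelForm hp.symm (z := fun θ =>
    Real.sin θ • z.1 + Real.cos θ • z.2) (z' := fun i => Real.cos θ * z.1 i - Real.sin θ * z.2 i)
    (u := θ) fun k => by
      refine (((Real.hasDerivAt_sin θ).mul_const (z.1 k)).add
        ((Real.hasDerivAt_cos θ).mul_const (z.2 k))).congr_deriv ?_
      ring)
  refine h1.congr_deriv ?_
  rw [Finset.mul_sum, Finset.mul_sum]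
  refine Finset.sum_congr rfl fun i _ => ?_
  rw [formGrad]; ring

/-- Comparison of a projection quadratic form in independent variables with its Gaussian
counterpart. -/
theorem abs_integral_kernelForm_sub_gaussian_le (hμ : ∀ i, HasNormalizedMoments (μ i) M)
    (hp : IsProjKernel p) (H : IsSmoothTest h h₁ h₂ h₃ B) :
    |∫ x, h (kernelForm p x) ∂Measure.pi μ - ∫ y, h (kernelForm p y) ∂gaussianPi ι| ≤
      648 * M * ∑ i, √(p i i) ^ 3 := by
  have hder := hasDerivAt_interpolation hμ hp H
  -- The half-open interval keeps `cos θ` positive, which the smoothing requires; the mean value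
  -- inequality with right derivatives needs no more.
  have hb : ∀ θ ∈ Set.Ico 0 (Real.pi / 2), ‖∑ i, ∫ z : (ι → ℝ) × (ι → ℝ),
      (Real.cos θ * z.1 i - Real.sin θ * z.2 i) *
        formGrad p h₁ i (Real.sin θ • z.1 + Real.cos θ • z.2)
        ∂((Measure.pi μ).prod (gaussianPi ι))‖ ≤ 324 * M * ∑ i, √(p i i) ^ 3 := by
    intro θ hθ
    have hc0 : 0 < Real.cos θ :=
      Real.cos_pos_of_mem_Ioo ⟨by linarith [hθ.1, Real.pi_pos], hθ.2⟩
    have hs0 : 0 ≤ Real.sin θ :=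
      Real.sin_nonneg_of_nonneg_of_le_pi hθ.1 (by linarith [hθ.2, Real.pi_pos])
    rw [Finset.mul_sum]
    refine (norm_sum_le _ _).trans (Finset.sum_le_sum fun i _ => ?_)
    have hI := (hder θ).2 i
    -- Integrating the `y i` term by parts leaves `cos θ` times a Stein discrepancy in `x i`.
    have e : ∀ x : ι → ℝ, ∫ y, (Real.cos θ * x i - Real.sin θ * y i) *
        formGrad p h₁ i (Real.sin θ • x + Real.cos θ • y) ∂gaussianPi ι =
        Real.cos θ * x i * gaussianSmooth (Real.cos θ) (formGrad p h₁ i) (Real.sin θ • x) -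
        Real.sin θ * (Real.cos θ *
          gaussianSmooth (Real.cos θ) (formHess p h₁ h₂ i) (Real.sin θ • x)) := fun x => by
      rw [← integral_eval_mul_formGrad hp H, gaussianSmooth, ← integral_const_mul,
        ← integral_const_mul, ← integral_sub]
      · congr 1; ext y; ring
      · exact ((polyGrowth_formGrad H _ _ i).const_mul _).integrable_pi_gaussianReal
      · exact (((PolyGrowth.eval i).mul
          (polyGrowth_formGrad H _ _ i)).const_mul _).integrable_pi_gaussianReal
    rw [integral_prod _ hI]
    have hI2 := hI.integral_prod_left
    simp only [e] at hI2 ⊢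
    exact abs_integral_resample_le hμ hp H hs0 (Real.sin_le_one θ) hc0 (Real.cos_le_one θ) i hI2
  have hmv := norm_image_sub_le_of_norm_deriv_right_le_segment
    (fun θ _ => (hder θ).1.continuousAt.continuousWithinAt)
    (fun θ _ => (hder θ).1.hasDerivWithinAt) hb (Real.pi / 2)
    (Set.right_mem_Icc.2 (by positivity))
  simp only [Real.sin_pi_div_two, Real.cos_pi_div_two, Real.sin_zero, Real.cos_zero, one_smul,
    zero_smul, add_zero, zero_add, sub_zero] at hmv
  rw [integral_fun_fst (fun x => h (kernelForm p x)),
    integral_fun_snd (fun x => h (kernelForm p x))] at hmv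
  simp only [probReal_univ, one_smul, Real.norm_eq_abs] at hmv
  refine hmv.trans ?_
  have h0 : 0 ≤ 324 * M * ∑ i, √(p i i) ^ 3 := (norm_nonneg _).trans
    (hb 0 ⟨le_rfl, by positivity⟩)
  -- The path has length `π / 2 ≤ 2`, which doubles 324 to 648.
  have := Real.pi_le_four
  nlinarith

end interpolation

/-! ### From smooth test functions to the full test class. -/

theorem norm_sub_le_of_hasDerivAt_bound {g g' : ℝ → ℝ} (hg : ∀ x, HasDerivAt g (g' x) x)
    (hb : ∀ x, |g' x| ≤ 1) (x y : ℝ) : |g y - g x| ≤ |y - x| := by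
  have := Convex.norm_image_sub_le_of_norm_hasDerivWithin_le (f := g) (f' := g')
    (s := Set.univ) (x := x) (y := y) (C := 1) (fun x _ => (hg x).hasDerivWithinAt)
    (fun x _ => hb x) convex_univ (Set.mem_univ _) (Set.mem_univ _)
  simpa using this

/-- The Steklov means of a test function are smooth test functions approximating it uniformly. -/
theorem exists_isSmoothTest {φ : ℝ → ℝ} (hφ : φ ∈ testClass) {ε : ℝ} (hε : 0 < ε) :
    ∃ h h₁ h₂ h₃ B, IsSmoothTest h h₁ h₂ h₃ B ∧ ∀ x, |h x - φ x| ≤ ε := by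
  obtain ⟨d1, d2, b1, b2⟩ := hφ
  have D1 : ∀ x, HasDerivAt φ (deriv φ x) x := fun x => (d1 x).hasDerivAt
  have D2 : ∀ x, HasDerivAt (deriv φ) (deriv (deriv φ) x) x := fun x => (d2 x).hasDerivAt
  have sh : ∀ {g g' : ℝ → ℝ}, (∀ x, HasDerivAt g (g' x) x) →
      ∀ x, HasDerivAt (fun x => (g (x + ε) - g x) / ε) ((g' (x + ε) - g' x) / ε) x :=
    fun hg x => (((hg (x + ε)).comp_add_const x ε).sub (hg x)).div_const ε
  have bd : ∀ {g g' : ℝ → ℝ}, (∀ x, HasDerivAt g (g' x) x) → (∀ x, |g' x| ≤ 1) →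
      ∀ x, |(g (x + ε) - g x) / ε| ≤ 1 := fun hg hb x => by
    rw [abs_div, abs_of_pos hε, div_le_one hε]
    have := norm_sub_le_of_hasDerivAt_bound hg hb x (x + ε)
    rwa [add_sub_cancel_left, abs_of_pos hε] at this
  have hc : Continuous φ := d1.continuous
  have hP : ∀ x, HasDerivAt (fun u => ∫ t in (0 : ℝ)..u, φ t) (φ x) x := fun x =>
    intervalIntegral.integral_hasDerivAt_right (hc.intervalIntegrable _ _)
      (hc.stronglyMeasurableAtFilter _ _) hc.continuousAt
  -- Averaging over `[x, x + ε]` gains one derivative and keeps the first two bounds; the third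
  -- derivative is a difference quotient of `φ''`, bounded by `2 / ε`.
  refine ⟨fun x => ((∫ t in (0 : ℝ)..(x + ε), φ t) - ∫ t in (0 : ℝ)..x, φ t) / ε,
    fun x => (φ (x + ε) - φ x) / ε, fun x => (deriv φ (x + ε) - deriv φ x) / ε,
    fun x => (deriv (deriv φ) (x + ε) - deriv (deriv φ) x) / ε, 2 / ε,
    ⟨sh hP, sh D1, sh D2, bd D1 b1, bd D2 b2, fun x => ?_⟩, fun x => ?_⟩
  · rw [abs_div, abs_of_pos hε]
    gcongr
    exact (abs_sub _ _).trans (by linarith [b2 (x + ε), b2 x])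
  · simp only
    rw [intervalIntegral.integral_interval_sub_left (hc.intervalIntegrable _ _)
      (hc.intervalIntegrable _ _)]
    have e : (∫ t in x..(x + ε), φ t) / ε - φ x = (∫ t in x..(x + ε), (φ t - φ x)) / ε := by
      rw [intervalIntegral.integral_sub (hc.intervalIntegrable _ _) (by simp)]
      rw [intervalIntegral.integral_const]
      simp only [smul_eq_mul]
      field_simp
      ring
    rw [e, abs_div, abs_of_pos hε, div_le_iff₀ hε]
    have := intervalIntegral.norm_integral_le_of_norm_le_const (a := x) (b := x + ε)
      (f := fun t => φ t - φ x) (C := ε) fun t ht => by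
        rw [Set.uIoc_of_le (by linarith)] at ht
        refine (norm_sub_le_of_hasDerivAt_bound D1 b1 x t).trans ?_
        rw [abs_of_nonneg (by linarith [ht.1])]
        linarith [ht.2]
    rwa [add_sub_cancel_left, abs_of_pos hε] at this

/-- Dividing by `K` offsets the chain rule factors `a` and `a²`. -/
theorem testClass_comp_affine {φ : ℝ → ℝ} (hφ : φ ∈ testClass) {a b K : ℝ} (hK : 0 < K)
    (h1 : |a| ≤ K) (h2 : a ^ 2 ≤ K) : (fun x => φ (a * x + b) / K) ∈ testClass := by
  obtain ⟨d1, d2, b1, b2⟩ := hφ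
  have hl : ∀ x, HasDerivAt (fun x => a * x + b) a x := fun x => by
    simpa using ((hasDerivAt_id x).const_mul a).add_const b
  have e1 : ∀ x, HasDerivAt (fun x => φ (a * x + b) / K) (deriv φ (a * x + b) * a / K) x :=
    fun x => ((d1 _).hasDerivAt.comp x (hl x)).div_const K
  have e2 : ∀ x, HasDerivAt (fun x => deriv φ (a * x + b) * a / K)
      (deriv (deriv φ) (a * x + b) * a * a / K) x :=
    fun x => (((d2 _).hasDerivAt.comp x (hl x)).mul_const a).div_const K
  have f1 : deriv (fun x => φ (a * x + b) / K) = fun x => deriv φ (a * x + b) * a / K :=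
    funext fun x => (e1 x).deriv
  refine ⟨fun x => (e1 x).differentiableAt, ?_, fun x => ?_, fun x => ?_⟩
  · rw [f1]; exact fun x => (e2 x).differentiableAt
  · rw [f1, abs_div, abs_of_pos hK, div_le_one hK, abs_mul]
    exact (mul_le_of_le_one_left (abs_nonneg _) (b1 _)).trans h1
  · rw [f1, (e2 x).deriv, abs_div, abs_of_pos hK, div_le_one hK, mul_assoc, abs_mul, ← sq,
      abs_of_nonneg (sq_nonneg a)]
    exact (mul_le_of_le_one_left (sq_nonneg _) (b2 _)).trans h2

theorem lipschitz_of_mem_testClass {φ : ℝ → ℝ} (hφ : φ ∈ testClass) (x y : ℝ) :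
    |φ y - φ x| ≤ |y - x| :=
  norm_sub_le_of_hasDerivAt_bound (fun x => (hφ.1 x).hasDerivAt) hφ.2.2.1 x y

theorem integrable_comp_of_mem_testClass {φ : ℝ → ℝ} (hφ : φ ∈ testClass) {Ω : Type*}
    [MeasurableSpace Ω] {P : Measure Ω} [IsProbabilityMeasure P] {Y : Ω → ℝ}
    (hY : Integrable Y P) : Integrable (fun ω => φ (Y ω)) P := by
  refine ((integrable_const |φ 0|).fun_add hY.norm).mono'
    (hφ.1.continuous.comp_aestronglyMeasurable hY.aestronglyMeasurable)
    (Filter.Eventually.of_forall fun ω => ?_)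
  have h1 := lipschitz_of_mem_testClass hφ 0 (Y ω)
  have h2 := abs_sub_abs_le_abs_sub (φ (Y ω)) (φ 0)
  rw [sub_zero] at h1
  simp only [Real.norm_eq_abs]
  linarith

section
variable {ι : Type*} [Fintype ι] [DecidableEq ι] {μ : ι → Measure ℝ}
  [∀ i, IsProbabilityMeasure (μ i)] {M : ℝ} {p : ι → ι → ℝ}

theorem integrable_kernelForm_pi (hμ : ∀ i, HasNormalizedMoments (μ i) M) (f : ι → ι → ℝ) :
    Integrable (kernelForm f) (Measure.pi μ) := by
  unfold kernelForm kernelCoord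
  exact integrable_finsetSum _ fun i _ => (memLp_two_eval_pi hμ i).integrable_mul
    (memLp_finsetSum _ fun j _ => (memLp_two_eval_pi hμ j).const_mul _)

/-- The third-derivative bound of the approximants blows up as `ε → 0`, but the smooth comparison
does not depend on it, so the limit costs nothing. -/
theorem abs_integral_kernelForm_sub_gaussian_le_of_mem (hμ : ∀ i, HasNormalizedMoments (μ i) M)
    (hp : IsProjKernel p) {φ : ℝ → ℝ} (hφ : φ ∈ testClass) :
    |∫ x, φ (kernelForm p x) ∂Measure.pi μ - ∫ y, φ (kernelForm p y) ∂gaussianPi ι| ≤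
      648 * M * ∑ i, √(p i i) ^ 3 := by
  refine le_of_forall_pos_le_add fun ε hε => ?_
  obtain ⟨h, h₁, h₂, h₃, B, H, hh⟩ := exists_isSmoothTest hφ (half_pos hε)
  have key : ∀ {ν : ι → Measure ℝ} [∀ i, IsProbabilityMeasure (ν i)] {N : ℝ},
      (∀ i, HasNormalizedMoments (ν i) N) → |∫ x, φ (kernelForm p x) ∂Measure.pi ν -
        ∫ x, h (kernelForm p x) ∂Measure.pi ν| ≤ ε / 2 := by
    intro ν _ N hν
    rw [← integral_sub (integrable_comp_of_mem_testClass hφ (integrable_kernelForm_pi hν p))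
      (integrable_comp_kernelForm H (Z := fun x => x) measurable_id
        fun i => memLp_two_eval_pi hν i)]
    have := norm_integral_le_of_norm_le (μ := Measure.pi ν)
      (f := fun x => φ (kernelForm p x) - h (kernelForm p x)) (integrable_const (ε / 2))
      (Filter.Eventually.of_forall fun x => by
        rw [Real.norm_eq_abs, abs_sub_comm]; exact hh _)
    simpa using this
  have k1 := abs_le.1 (key hμ)
  have k2 := abs_le.1 (key (ν := fun _ : ι => gaussianReal 0 1)
    fun _ => normalizedMoments_gaussianReal)
  have k3 := abs_le.1 (abs_integral_kernelForm_sub_gaussian_le hμ hp H)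
  rw [abs_le]
  constructor <;> linarith [k1.1, k1.2, k2.1, k2.2, k3.1, k3.2]

end

/-! ### Gamma laws and chi-square laws. -/

theorem integrable_gammaMeasure_iff {r l : ℝ} (hr : 0 < r) (hl : 0 < l) (f : ℝ → ℝ) :
    Integrable f (gammaMeasure r l) ↔
      IntegrableOn (fun x => x ^ (r - 1) * Real.exp (-(l * x)) * f x) (Set.Ioi 0) := by
  have h0 : (l ^ r / Real.Gamma r) ≠ 0 :=
    div_ne_zero (Real.rpow_pos_of_pos hl _).ne' (Real.Gamma_pos_of_pos hr).ne'
  rw [gammaMeasure, integrable_withDensity_iff (by unfold gammaPDF; fun_prop)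
    (Filter.Eventually.of_forall fun x => by simp [gammaPDF]),
    ← integrableOn_Ici_iff_integrableOn_Ioi, ← integrable_indicator_iff measurableSet_Ici]
  refine (integrable_congr (Filter.Eventually.of_forall fun x => ?_)).trans
    (integrable_const_mul_iff h0.isUnit _)
  simp only [gammaPDF, ENNReal.toReal_ofReal (gammaPDFReal_nonneg hr hl x)]
  by_cases hx : 0 ≤ x
  · simp [gammaPDFReal, hx]; ring
  · simp [gammaPDFReal, hx]

theorem integral_gammaMeasure {r l : ℝ} (hr : 0 < r) (hl : 0 < l) (f : ℝ → ℝ) :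
    ∫ x, f x ∂gammaMeasure r l = l ^ r / Real.Gamma r *
      ∫ x in Set.Ioi 0, x ^ (r - 1) * Real.exp (-(l * x)) * f x := by
  rw [gammaMeasure, integral_withDensity_eq_integral_toReal_smul (by unfold gammaPDF; fun_prop)
    (Filter.Eventually.of_forall fun x => by simp [gammaPDF]), ← integral_Ici_eq_integral_Ioi,
    ← integral_indicator measurableSet_Ici, ← integral_const_mul]
  congr 1
  ext x
  simp only [gammaPDF, ENNReal.toReal_ofReal (gammaPDFReal_nonneg hr hl x)]
  by_cases hx : 0 ≤ x
  · simp [gammaPDFReal, hx]; ring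
  · simp [gammaPDFReal, hx]

theorem integrable_exp_mul_gammaMeasure {r l t : ℝ} (hr : 0 < r) (hl : 0 < l) (ht : t < l) :
    Integrable (fun x => Real.exp (t * x)) (gammaMeasure r l) := by
  rw [integrable_gammaMeasure_iff hr hl]
  have := integrableOn_rpow_mul_exp_neg_mul_rpow (p := 1) (s := r - 1) (b := l - t) (by linarith)
    one_pos (by linarith)
  refine this.congr_fun (fun x _ => ?_) measurableSet_Ioi
  simp only [Real.rpow_one]
  rw [mul_assoc, ← Real.exp_add]
  congr 2; ring

/-- The value 0 for `t ≥ l` is the default integral of a non-integrable function. It is recorded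
because the generating functions are later compared at every real `t`. -/
theorem mgf_gammaMeasure {r l t : ℝ} (hr : 0 < r) (hl : 0 < l) :
    mgf id (gammaMeasure r l) t = if t < l then (l / (l - t)) ^ r else 0 := by
  have e : ∀ x : ℝ, x ^ (r - 1) * Real.exp (-(l * x)) * Real.exp (t * x) =
      x ^ (r - 1) * Real.exp (-((l - t) * x)) := fun x => by
    rw [mul_assoc, ← Real.exp_add]; congr 2; ring
  split_ifs with ht
  · have ht' : 0 < l - t := by linarith
    simp only [mgf, id]
    rw [integral_gammaMeasure hr hl]
    simp only [e]
    rw [Real.integral_rpow_mul_exp_neg_mul_Ioi hr ht', one_div, div_eq_mul_inv l,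
      Real.mul_rpow hl.le (inv_nonneg.2 ht'.le)]
    have := (Real.Gamma_pos_of_pos hr).ne'
    field_simp
  · simp only [mgf, id]
    refine integral_undef fun hI => ?_
    rw [integrable_gammaMeasure_iff hr hl] at hI
    refine not_integrableOn_Ioi_rpow (r - 1) (Integrable.mono' hI (by fun_prop) ?_)
    refine (ae_restrict_iff' measurableSet_Ioi).2 (Filter.Eventually.of_forall fun x hx => ?_)
    have hx' : 0 < x := hx
    rw [Real.norm_of_nonneg (Real.rpow_nonneg hx'.le _), e]
    refine le_mul_of_one_le_right (Real.rpow_nonneg hx'.le _) (Real.one_le_exp ?_)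
    nlinarith

theorem mgf_mul_sq_gaussianReal {a : ℝ} (ha : 0 < a) (t : ℝ) :
    mgf (fun y => a * y ^ 2) (gaussianReal 0 1) t =
      if t < 1 / (2 * a) then (1 / (2 * a) / (1 / (2 * a) - t)) ^ (1 / 2 : ℝ) else 0 := by
  have e : ∀ y : ℝ, gaussianPDFReal 0 1 y * Real.exp (t * (a * y ^ 2)) =
      (√(2 * Real.pi))⁻¹ * Real.exp (-(1 / 2 - t * a) * y ^ 2) := fun y => by
    simp only [gaussianPDFReal, NNReal.coe_one, mul_one, sub_zero]
    rw [mul_assoc, ← Real.exp_add]; congr 2; ring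
  simp only [mgf]
  rw [integral_gaussianReal_eq_integral_smul one_ne_zero]
  simp only [smul_eq_mul, e]
  rw [integral_const_mul, integral_gaussian]
  split_ifs with ht
  · rw [lt_div_iff₀ (by positivity)] at ht
    rw [← Real.sqrt_eq_rpow, ← Real.sqrt_inv, ← Real.sqrt_mul (by positivity)]
    congr 1
    have h1 : 1 / 2 - t * a ≠ 0 := by linarith
    have h2 : 1 / (2 * a) - t = (1 / 2 - t * a) / a := by field_simp
    rw [h2]
    field_simp
  · rw [not_lt, div_le_iff₀ (by positivity)] at ht
    -- In the divergent range the closed formula also gives 0, by the conventions for square roots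
    -- of nonpositive numbers and for division by zero.
    rw [Real.sqrt_eq_zero_of_nonpos (x := Real.pi / _), mul_zero]
    exact div_nonpos_of_nonneg_of_nonpos Real.pi_pos.le (by linarith)

/-- Analytic continuation to the imaginary axis identifies the characteristic functions. -/
theorem ext_of_mgf_eq {μ ν : Measure ℝ} [IsProbabilityMeasure μ] [IsProbabilityMeasure ν]
    (h : mgf id μ = mgf id ν) (h0 : 0 ∈ interior (integrableExpSet id μ)) : μ = ν := by
  refine Measure.ext_of_charFun (funext fun t => ?_)
  have := eqOn_complexMGF_of_mgf h (x := (t : ℂ) * Complex.I) (by simpa using h0)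
  rwa [complexMGF_id_mul_I, complexMGF_id_mul_I] at this

/-- The chi-square law as a Gamma law. -/
theorem map_sum_sq_gaussianPi {ι : Type*} [Fintype ι] (I : Finset ι) (hI : I.Nonempty) {a : ℝ}
    (ha : 0 < a) :
    (gaussianPi ι).map (fun y => a * ∑ k ∈ I, y k ^ 2) =
      gammaMeasure ((I.card : ℝ) / 2) (1 / (2 * a)) := by
  have hr : (0 : ℝ) < (I.card : ℝ) / 2 := by
    have := hI.card_pos
    positivity
  have hl : 0 < 1 / (2 * a) := by positivity
  have hm : Measurable fun y : ι → ℝ => a * ∑ k ∈ I, y k ^ 2 := by fun_prop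
  have := isProbabilityMeasure_gammaMeasure hr hl
  have : IsProbabilityMeasure ((gaussianPi ι).map (fun y => a * ∑ k ∈ I, y k ^ 2)) :=
    Measure.isProbabilityMeasure_map hm.aemeasurable
  symm
  refine ext_of_mgf_eq (funext fun t => ?_) ?_
  · rw [mgf_gammaMeasure hr hl, mgf_id_map hm.aemeasurable]
    have hind : iIndepFun (fun (k : ι) (y : ι → ℝ) => a * y k ^ 2) (gaussianPi ι) :=
      iIndepFun_pi (X := fun _ x => a * x ^ 2) fun _ => by fun_prop
    have e : (fun y : ι → ℝ => a * ∑ k ∈ I, y k ^ 2) = ∑ k ∈ I, fun y : ι → ℝ => a * y k ^ 2 := by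
      ext y; simp [Finset.mul_sum]
    rw [e, hind.mgf_sum (fun _ => by fun_prop)]
    have h1 : ∀ k : ι, mgf (fun y : ι → ℝ => a * y k ^ 2) (gaussianPi ι) t =
        mgf (fun y => a * y ^ 2) (gaussianReal 0 1) t := fun k => by
      simp only [mgf]
      rw [← (measurePreserving_eval (fun _ : ι => gaussianReal 0 1) k).map_eq, integral_map]
      · exact (measurable_pi_apply k).aemeasurable
      · fun_prop
    simp only [h1, Finset.prod_const, mgf_mul_sq_gaussianReal ha]
    split_ifs with ht
    · rw [← Real.rpow_natCast, ← Real.rpow_mul]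
      · congr 1; ring
      · exact div_nonneg hl.le (by linarith)
    · rw [zero_pow hI.card_pos.ne']
  · rw [mem_interior_iff_mem_nhds]
    exact Filter.mem_of_superset (Iio_mem_nhds hl) fun t ht =>
      integrable_exp_mul_gammaMeasure hr hl ht

theorem integrable_id_centeredGamma {r l : ℝ} (hr : 0 < r) (hl : 0 < l) :
    Integrable (fun x => x) (centeredGamma r l) := by
  have := isProbabilityMeasure_gammaMeasure hr hl
  have h0 : (0 : ℝ) ∈ interior (integrableExpSet id (gammaMeasure r l)) := by
    rw [mem_interior_iff_mem_nhds]
    exact Filter.mem_of_superset (Iio_mem_nhds hl) fun t ht =>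
      integrable_exp_mul_gammaMeasure hr hl ht
  have h1 : Integrable (fun x : ℝ => x) (gammaMeasure r l) :=
    memLp_one_iff_integrable.1
      (by simpa [Function.id_def] using memLp_of_mem_interior_integrableExpSet h0 1)
  unfold centeredGamma
  rw [integrable_map_measure (by fun_prop) (by fun_prop)]
  exact h1.sub (integrable_const _)

/-! ### Spectral calculus and rotation invariance. -/

/-- The matrix with eigenvectors `b k` and eigenvalues `c k`. -/
noncomputable def spectralKernel {ι : Type*} [Fintype ι]
    (b : OrthonormalBasis ι ℝ (EuclideanSpace ℝ ι)) (c : ι → ℝ) (i j : ι) : ℝ :=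
  ∑ k, c k * b k i * b k j

section spectral
variable {ι : Type*} [Fintype ι] [DecidableEq ι]
  (b : OrthonormalBasis ι ℝ (EuclideanSpace ℝ ι)) (c c' : ι → ℝ)

theorem orthonormalBasis_sum_mul (k l : ι) : ∑ i, b k i * b l i = if k = l then 1 else 0 := by
  have h := orthonormal_iff_ite.1 b.orthonormal k l
  rw [← h, PiLp.inner_apply]
  exact Finset.sum_congr rfl fun i _ => by simp [mul_comm]

theorem orthonormalBasis_sum_mul' (i j : ι) : ∑ k, b k i * b k j = if i = j then 1 else 0 := by
  have h := b.sum_inner_mul_inner (EuclideanSpace.single i (1 : ℝ)) (EuclideanSpace.single j 1)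
  simp only [EuclideanSpace.inner_single_left, EuclideanSpace.inner_single_right, map_one,
    one_mul] at h
  simpa [PiLp.single_apply, eq_comm] using h

theorem spectralKernel_symm (i j : ι) : spectralKernel b c i j = spectralKernel b c j i :=
  Finset.sum_congr rfl fun k _ => by ring

/-- Orthonormality of the eigenvectors. With the trace and Hilbert-Schmidt formulas below, it
reduces matrix statements to eigenvalues. -/
theorem spectralKernel_mul (i m : ι) :
    ∑ j, spectralKernel b c i j * spectralKernel b c' j m =
      spectralKernel b (fun k => c k * c' k) i m := by
  have h1 : ∀ j, spectralKernel b c i j * spectralKernel b c' j m = ∑ k, ∑ l,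
      c k * b k i * (c' l * b l m) * (b k j * b l j) := fun j => by
    unfold spectralKernel
    rw [Finset.sum_mul_sum]
    exact Finset.sum_congr rfl fun k _ => Finset.sum_congr rfl fun l _ => by ring
  simp only [h1]
  rw [Finset.sum_comm]
  refine Finset.sum_congr rfl fun k _ => ?_
  rw [Finset.sum_comm]
  simp only [← Finset.mul_sum, orthonormalBasis_sum_mul b, mul_ite, mul_one, mul_zero,
    Finset.sum_ite_eq, Finset.mem_univ, if_true]
  ring

theorem spectralKernel_trace : ∑ i, spectralKernel b c i i = ∑ k, c k := by
  unfold spectralKernel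
  rw [Finset.sum_comm]
  refine Finset.sum_congr rfl fun k _ => ?_
  simp only [mul_assoc, ← Finset.mul_sum, orthonormalBasis_sum_mul b, if_true, mul_one]

theorem spectralKernel_sum_sq : ∑ i, ∑ j, spectralKernel b c i j ^ 2 = ∑ k, c k ^ 2 := by
  have h1 : ∀ i, ∑ j, spectralKernel b c i j ^ 2 =
      spectralKernel b (fun k => c k * c k) i i := fun i => by
    rw [← spectralKernel_mul]
    exact Finset.sum_congr rfl fun j _ => by rw [sq, spectralKernel_symm b c j i]
  simp only [h1, spectralKernel_trace]
  exact Finset.sum_congr rfl fun k _ => (sq _).symm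

theorem spectralKernel_sub (i j : ι) :
    spectralKernel b c i j - spectralKernel b c' i j =
      spectralKernel b (fun k => c k - c' k) i j := by
  unfold spectralKernel
  rw [← Finset.sum_sub_distrib]
  exact Finset.sum_congr rfl fun k _ => by ring

theorem isProjKernel_spectralKernel (hc : ∀ k, c k * c k = c k) :
    IsProjKernel (spectralKernel b c) where
  symm := spectralKernel_symm b c
  idem i k := by rw [spectralKernel_mul]; simp only [hc]

/-- The standard Gaussian law on a Euclidean space has the same coordinate description in every
orthonormal basis. -/
theorem map_rotation_gaussianPi :
    (gaussianPi ι).map (fun (y : ι → ℝ) (i : ι) => ∑ l, y l * b l i) = gaussianPi ι := by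
  have h1 := (map_pi_eq_stdGaussian (ι := ι)).trans (stdGaussian_eq_map_pi_orthonormalBasis b)
  have h2 := congrArg (fun m => Measure.map (WithLp.ofLp) m) h1
  simp only at h2
  rw [Measure.map_map (by fun_prop) (by fun_prop), Measure.map_map (by fun_prop) (by fun_prop)]
    at h2
  have e1 : (WithLp.ofLp ∘ WithLp.toLp 2 : (ι → ℝ) → ι → ℝ) = id := rfl
  rw [e1, Measure.map_id] at h2
  rw [gaussianPi, h2]
  congr 1
  · ext y i
    simp
  · rw [← h2]

theorem kernelForm_spectralKernel_rotation (y : ι → ℝ) :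
    kernelForm (spectralKernel b c) (fun i => ∑ l, y l * b l i) = ∑ k, c k * y k ^ 2 := by
  have h0 : ∀ z : ι → ℝ, kernelForm (spectralKernel b c) z = ∑ k, c k * (∑ i, b k i * z i) ^ 2 := by
    intro z
    have h1 : ∀ k, c k * (∑ i, b k i * z i) ^ 2 = ∑ i, ∑ j, z i * (c k * b k i * b k j * z j) :=
      fun k => by
        rw [sq, Finset.sum_mul_sum, Finset.mul_sum]
        refine Finset.sum_congr rfl fun i _ => ?_
        rw [Finset.mul_sum]
        exact Finset.sum_congr rfl fun j _ => by ring
    simp only [h1]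
    rw [Finset.sum_comm]
    unfold kernelForm kernelCoord spectralKernel
    refine Finset.sum_congr rfl fun i _ => ?_
    rw [Finset.sum_comm, Finset.mul_sum]
    refine Finset.sum_congr rfl fun j _ => ?_
    rw [Finset.sum_mul, Finset.mul_sum]
  rw [h0]
  refine Finset.sum_congr rfl fun k _ => ?_
  congr 2
  simp only [Finset.mul_sum]
  rw [Finset.sum_comm]
  have h2 : ∀ l, ∑ i, b k i * (y l * b l i) = y l * ∑ i, b k i * b l i := fun l => by
    rw [Finset.mul_sum]
    exact Finset.sum_congr rfl fun i _ => by ring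
  simp only [h2, orthonormalBasis_sum_mul b, mul_ite, mul_one, mul_zero, Finset.sum_ite_eq,
    Finset.mem_univ, if_true]

/-- The law of a Gaussian projection quadratic form. -/
theorem map_kernelForm_spectralKernel (I : Finset ι) (hI : I.Nonempty) {a : ℝ} (ha : 0 < a) :
    (gaussianPi ι).map (fun y => a * kernelForm (spectralKernel b fun k =>
      if k ∈ I then 1 else 0) y) = gammaMeasure ((I.card : ℝ) / 2) (1 / (2 * a)) := by
  rw [← map_sum_sq_gaussianPi I hI ha]
  conv_lhs => rw [← map_rotation_gaussianPi b]
  rw [Measure.map_map (measurable_kernelForm.const_mul a) (by fun_prop)]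
  congr 1
  ext y
  simp only [Function.comp, kernelForm_spectralKernel_rotation]
  simp

theorem exists_eq_spectralKernel {f : ι → ι → ℝ} (hf : ∀ i j, f i j = f j i) :
    ∃ (b : OrthonormalBasis ι ℝ (EuclideanSpace ℝ ι)) (c : ι → ℝ), f = spectralKernel b c := by
  have hA : (Matrix.of f).IsHermitian := by
    ext i j; simp [hf i j]
  refine ⟨hA.eigenvectorBasis, hA.eigenvalues, ?_⟩
  ext i j
  set b := hA.eigenvectorBasis
  have h1 : ∀ k, ∑ m, f i m * b k m = hA.eigenvalues k * b k i := fun k => by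
    have := congrFun (hA.mulVec_eigenvectorBasis k) i
    simpa [Matrix.mulVec, dotProduct] using this
  have h2 : f i j = ∑ m, f i m * ∑ k, b k m * b k j := by
    simp [orthonormalBasis_sum_mul' b]
  rw [h2]
  simp only [Finset.mul_sum]
  rw [Finset.sum_comm]
  unfold spectralKernel
  refine Finset.sum_congr rfl fun k _ => ?_
  rw [← h1 k, Finset.sum_mul]
  exact Finset.sum_congr rfl fun m _ => by ring

end spectral

/-! ### Comparison of a diagonal-free form with a centered Gamma law. -/

section comparison
variable {ι : Type*} [Fintype ι] [DecidableEq ι] {μ : ι → Measure ℝ}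
  [∀ i, IsProbabilityMeasure (μ i)] {M : ℝ} {p : ι → ι → ℝ}

/-- The law of a quadratic form of an orthogonal projection in a standard Gaussian vector. -/
theorem IsProjKernel.map_kernelForm_gaussianPi (hp : IsProjKernel p) (ht : 0 < ∑ i, p i i)
    {a : ℝ} (ha : 0 < a) :
    (gaussianPi ι).map (fun y => a * kernelForm p y) =
      gammaMeasure ((∑ i, p i i) / 2) (1 / (2 * a)) := by
  obtain ⟨b, c, rfl⟩ := exists_eq_spectralKernel hp.symm
  -- The Hilbert-Schmidt norm of `p - p² = 0` is the sum of squares of these numbers.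
  have hc : ∀ k, c k - c k * c k = 0 := by
    have h1 : ∑ k, (c k - c k * c k) ^ 2 = 0 := by
      rw [← spectralKernel_sum_sq b]
      refine Finset.sum_eq_zero fun i _ => Finset.sum_eq_zero fun j _ => ?_
      rw [← spectralKernel_sub, ← spectralKernel_mul, hp.idem, sub_self, zero_pow two_ne_zero]
    rw [Finset.sum_eq_zero_iff_of_nonneg fun k _ => sq_nonneg _] at h1
    exact fun k => by simpa using h1 k (Finset.mem_univ k)
  set I := Finset.univ.filter fun k => c k ≠ 0 with hI
  have hcI : c = fun k => if k ∈ I then 1 else 0 := by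
    ext k
    by_cases h : c k = 0
    · simp [hI, h]
    · have : c k * (1 - c k) = 0 := by linarith [hc k]
      rcases mul_eq_zero.1 this with h' | h'
      · exact absurd h' h
      · simp [hI, h]; linarith
  have hcard : ∑ i, spectralKernel b c i i = I.card := by
    rw [spectralKernel_trace, hcI]; simp
  rw [hcard] at ht ⊢
  have hne : I.Nonempty := Finset.card_pos.1 (by exact_mod_cast ht)
  rw [← map_kernelForm_spectralKernel b I hne ha, ← hcI]

theorem integral_abs_le_sqrt {Ω : Type*} [MeasurableSpace Ω] {P : Measure Ω}
    [IsProbabilityMeasure P] {Y : Ω → ℝ} (hY : MemLp Y 2 P) :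
    ∫ ω, |Y ω| ∂P ≤ √(∫ ω, Y ω ^ 2 ∂P) := by
  refine Real.le_sqrt_of_sq_le ?_
  have h1 : MemLp (fun ω => |Y ω|) 2 P := hY.norm
  have h2 := variance_nonneg (fun ω => |Y ω|) P
  rw [variance_eq_sub h1] at h2
  simp only [Pi.pow_apply, sq_abs] at h2
  linarith

/-- Cauchy-Schwarz on the factorization of the `3/2` power as `√(p i i) * p i i`. -/
theorem IsProjKernel.sum_sqrt_pow_le (hp : IsProjKernel p) :
    ∑ i, √(p i i) ^ 3 ≤ √(∑ i, p i i) * √(∑ i, p i i ^ 2) := by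
  have h := Real.sum_sqrt_mul_sqrt_le Finset.univ (f := fun i => p i i)
    (g := fun i => p i i ^ 2) (fun i => hp.diag_nonneg i) (fun i => sq_nonneg _)
  refine le_trans (le_of_eq (Finset.sum_congr rfl fun i _ => ?_)) h
  rw [Real.sqrt_sq (hp.diag_nonneg i), pow_succ, Real.sq_sqrt (hp.diag_nonneg i), mul_comm]

theorem kernelForm_sub (p f : ι → ι → ℝ) (x : ι → ℝ) :
    kernelForm (fun i j => p i j - f i j) x = kernelForm p x - kernelForm f x := by
  unfold kernelForm kernelCoord
  rw [← Finset.sum_sub_distrib]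
  refine Finset.sum_congr rfl fun i _ => ?_
  rw [← mul_sub, ← Finset.sum_sub_distrib]
  congr 1
  exact Finset.sum_congr rfl fun j _ => by ring

/-- A quadratic form without diagonal whose matrix is close to an orthogonal projection is close
to the corresponding centered chi-square variable. -/
theorem abs_integral_kernelForm_sub_centered_gaussian_le (hM : 1 ≤ M)
    (hμ : ∀ i, HasNormalizedMoments (μ i) M) (hp : IsProjKernel p) {f : ι → ι → ℝ}
    (hf : ∀ i j, f i j = f j i) (hf0 : ∀ i, f i i = 0) {φ : ℝ → ℝ} (hφ : φ ∈ testClass) :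
    |∫ x, φ (kernelForm f x) ∂Measure.pi μ -
      ∫ y, φ (kernelForm p y - ∑ i, p i i) ∂gaussianPi ι| ≤
      (3 + 648 * √(∑ i, p i i)) * M * √(∑ i, ∑ j, (p i j - f i j) ^ 2) := by
  set E := ∑ i, ∑ j, (p i j - f i j) ^ 2 with hE
  have hE0 : 0 ≤ E := Finset.sum_nonneg fun i _ => Finset.sum_nonneg fun j _ => sq_nonneg _
  have hφ' : (fun x => φ (x - ∑ i, p i i)) ∈ testClass := by
    have := testClass_comp_affine hφ (a := 1) (b := -∑ i, p i i) one_pos (by simp) (by simp)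
    simpa [sub_eq_add_neg] using this
  have h1 : |∫ x, φ (kernelForm f x) ∂Measure.pi μ -
      ∫ x, φ (kernelForm p x - ∑ i, p i i) ∂Measure.pi μ| ≤ 3 * M * √E := by
    obtain ⟨hL, hle⟩ := integral_centered_form_sq_le hμ (f := fun i j => p i j - f i j)
      fun i j => by rw [hp.symm, hf]
    have htr : ∑ i, (p i i - f i i) = ∑ i, p i i :=
      Finset.sum_congr rfl fun i _ => by rw [hf0, sub_zero]
    rw [htr] at hL hle
    rw [← integral_sub (integrable_comp_of_mem_testClass hφ (integrable_kernelForm_pi hμ f))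
      (integrable_comp_of_mem_testClass hφ' (integrable_kernelForm_pi hμ p))]
    have h2 : |∫ x, (φ (kernelForm f x) - φ (kernelForm p x - ∑ i, p i i)) ∂Measure.pi μ| ≤
        ∫ x, |kernelForm (fun i j => p i j - f i j) x - ∑ i, p i i| ∂Measure.pi μ := by
      rw [← Real.norm_eq_abs]
      refine norm_integral_le_of_norm_le (hL.integrable one_le_two).abs
        (Filter.Eventually.of_forall fun x => ?_)
      rw [Real.norm_eq_abs]
      refine (lipschitz_of_mem_testClass hφ _ _).trans (le_of_eq ?_)
      rw [kernelForm_sub, ← abs_neg]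
      congr 1; ring
    refine (h2.trans (integral_abs_le_sqrt hL)).trans ((Real.sqrt_le_sqrt hle).trans ?_)
    rw [← hE, Real.sqrt_mul (by linarith)]
    -- Here `4 + 2 M ≤ 9 M²` because `M ≥ 1`.
    refine mul_le_mul_of_nonneg_right (Real.sqrt_le_iff.2 ⟨by linarith, by nlinarith⟩)
      (Real.sqrt_nonneg _)
  have h3 := abs_integral_kernelForm_sub_gaussian_le_of_mem hμ hp hφ'
  -- As `f i i = 0`, each `p i i ^ 2` is one of the terms of `E`: the diagonal of `p` is itself part
  -- of the approximation error.
  have h4 : ∑ i, √(p i i) ^ 3 ≤ √(∑ i, p i i) * √E := by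
    refine hp.sum_sqrt_pow_le.trans ?_
    gcongr
    refine Finset.sum_le_sum fun i _ => ?_
    have := Finset.single_le_sum (f := fun j => (p i j - f i j) ^ 2) (fun j _ => sq_nonneg _)
      (Finset.mem_univ i)
    simpa [hf0] using this
  have h5 : 648 * M * ∑ i, √(p i i) ^ 3 ≤ 648 * M * (√(∑ i, p i i) * √E) := by gcongr
  have h6 := abs_sub_le (∫ x, φ (kernelForm f x) ∂Measure.pi μ)
    (∫ x, φ (kernelForm p x - ∑ i, p i i) ∂Measure.pi μ)
    (∫ y, φ (kernelForm p y - ∑ i, p i i) ∂gaussianPi ι)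
  simp only at h3
  calc _ ≤ 3 * M * √E + 648 * M * (√(∑ i, p i i) * √E) := by linarith
    _ = _ := by ring

theorem integral_centeredGamma_eq (hp : IsProjKernel p) (ht : 0 < ∑ i, p i i) {a : ℝ}
    (ha : 0 < a) {φ : ℝ → ℝ} (hφ : Continuous φ) :
    ∫ y, φ y ∂centeredGamma ((∑ i, p i i) / 2) (1 / (2 * a)) =
      ∫ y, φ (a * (kernelForm p y - ∑ i, p i i)) ∂gaussianPi ι := by
  unfold centeredGamma
  have hφ' : Continuous fun x => φ (x - (∑ i, p i i) / 2 / (1 / (2 * a))) := by fun_prop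
  rw [integral_map (by fun_prop) hφ.aestronglyMeasurable,
    ← hp.map_kernelForm_gaussianPi ht ha,
    integral_map (measurable_kernelForm.const_mul a).aemeasurable hφ'.aestronglyMeasurable]
  congr 1
  ext y
  congr 1
  field_simp

end comparison

section transfer
variable {ι : Type*} [Fintype ι] {Ω : Type*} [MeasurableSpace Ω] {P : Measure Ω}
  [IsProbabilityMeasure P] {X : ι → Ω → ℝ}

theorem hasNormalizedMoments_map {Y : Ω → ℝ} {M : ℝ} (h4 : MemLp Y 4 P) (h1 : ∫ ω, Y ω ∂P = 0)
    (h2 : ∫ ω, Y ω ^ 2 ∂P = 1) (hM : ∫ ω, Y ω ^ 4 ∂P ≤ M) :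
    HasNormalizedMoments (P.map Y) M := by
  have hm := h4.aestronglyMeasurable.aemeasurable
  refine ⟨(memLp_map_measure_iff (by fun_prop) hm).2 h4, ?_, ?_, ?_⟩
  · rwa [integral_map hm (by fun_prop)]
  · rwa [integral_map hm (by fun_prop)]
  · rwa [integral_map hm (by fun_prop)]

theorem integral_map_eq_integral_pi (hX : iIndepFun X P) (hm : ∀ i, AEMeasurable (X i) P)
    {G : (ι → ℝ) → ℝ} (hG : Measurable G) {φ : ℝ → ℝ} (hφ : Continuous φ) :
    ∫ y, φ y ∂P.map (fun ω => G fun i => X i ω) =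
      ∫ x, φ (G x) ∂Measure.pi fun i => P.map (X i) := by
  have hXm : AEMeasurable (fun ω i => X i ω) P := aemeasurable_pi_lambda _ hm
  have hGX : AEMeasurable (fun ω => G fun i => X i ω) P := hG.comp_aemeasurable hXm
  have hφG : Measurable fun x => φ (G x) := hφ.measurable.comp hG
  rw [← hX.map_fun_eq_pi_map hm, integral_map hXm hφG.aestronglyMeasurable,
    integral_map hGX hφ.aestronglyMeasurable]

theorem kappa_le_of_forall {H : Set (ℝ → ℝ)} {μ ν : Measure ℝ} {K : ℝ}
    (h : ∀ φ ∈ H, |∫ x, φ x ∂μ - ∫ x, φ x ∂ν| ≤ K) : kappa H μ ν ≤ ENNReal.ofReal K :=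
  iSup₂_le fun φ hφ => ENNReal.ofReal_le_ofReal (h φ hφ)

end transfer

/-! ### Rounding to a projection, and the bound for quadratic forms. -/

/-- A real number stays away from the other natural numbers. -/
theorem exists_pos_le_abs_sub_natCast (ν : ℝ) :
    ∃ δ : ℝ, 0 < δ ∧ ∀ m : ℕ, (m : ℝ) ≠ ν → δ ≤ |ν - m| := by
  have hc : IsClosed ((fun m : ℕ => (m : ℝ)) '' {m | (m : ℝ) ≠ ν}) :=
    Nat.isClosedEmbedding_coe_real.isClosedMap _ (isClosed_discrete _)
  have hν : ν ∈ ((fun m : ℕ => (m : ℝ)) '' {m | (m : ℝ) ≠ ν})ᶜ := by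
    rintro ⟨m, hm, h⟩
    exact hm h
  obtain ⟨δ, hδ, hb⟩ := Metric.isOpen_iff.1 hc.isOpen_compl ν hν
  refine ⟨δ, hδ, fun m hm => ?_⟩
  by_contra! h
  refine hb (a := (m : ℝ)) ?_ ⟨m, hm, rfl⟩
  rwa [Metric.mem_ball, dist_comm, Real.dist_eq]

/-- By symmetry the contraction of a matrix with itself is its square, so the defect is read off the
eigenvalues. -/
theorem sum_sub_contr11_sq {n : ℕ} (b : OrthonormalBasis (Fin n) ℝ (EuclideanSpace ℝ (Fin n)))
    (c : Fin n → ℝ) : ∑ i, ∑ j, (spectralKernel b c i j -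
      contr11 (spectralKernel b c) (spectralKernel b c) i j) ^ 2 = ∑ k, (c k - c k * c k) ^ 2 := by
  rw [← spectralKernel_sum_sq b]
  refine Finset.sum_congr rfl fun i _ => Finset.sum_congr rfl fun j _ => ?_
  rw [← spectralKernel_sub, ← spectralKernel_mul, contr11]
  congr 2
  exact Finset.sum_congr rfl fun k _ => by rw [spectralKernel_symm b c j k]

/-- A symmetric matrix `f` with `f - f ^ 2` small is close to an orthogonal projection, whose rank
is the squared Hilbert-Schmidt norm of `f` if the latter difference is small enough. -/
theorem exists_isProjKernel_near {n : ℕ} {f : Fin n → Fin n → ℝ} (hf : ∀ i j, f i j = f j i) :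
    ∃ (p : Fin n → Fin n → ℝ) (d : ℕ), IsProjKernel p ∧ ∑ i, p i i = d ∧
      ∑ i, ∑ j, (p i j - f i j) ^ 2 ≤ 4 * ∑ i, ∑ j, (f i j - contr11 f f i j) ^ 2 ∧
      ((∑ i, ∑ j, f i j ^ 2) - d) ^ 2 ≤ 40 * (∑ i, ∑ j, f i j ^ 2) *
        ∑ i, ∑ j, (f i j - contr11 f f i j) ^ 2 := by
  obtain ⟨b, c, rfl⟩ := exists_eq_spectralKernel hf
  set e : Fin n → ℝ := fun k => if 1 / 2 < c k then 1 else 0 with he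
  have hee : ∀ k, e k * e k = e k := fun k => by simp only [he]; split_ifs <;> simp
  -- Of the two factors of `c (1 - c)`, one is the distance to the rounded value up to sign and the
  -- other is at least `1/2` in absolute value.
  have h1 : ∀ k, (e k - c k) ^ 2 ≤ 4 * (c k - c k * c k) ^ 2 := fun k => by
    simp only [he]
    split_ifs with h
    · have : 0 ≤ (2 * c k - 1) * (2 * c k + 1) * (1 - c k) ^ 2 := by
        have := sub_pos.2 h
        have h2 : 0 ≤ 2 * c k - 1 := by linarith
        have h3 : 0 ≤ 2 * c k + 1 := by linarith
        positivity
      nlinarith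
    · have h2 : 0 ≤ (1 - 2 * c k) * (3 - 2 * c k) * c k ^ 2 := by
        have h3 : 0 ≤ 1 - 2 * c k := by linarith
        have h4 : 0 ≤ 3 - 2 * c k := by linarith
        positivity
      nlinarith
  have h2 : ∑ k, (e k - c k) ^ 2 ≤ 4 * ∑ k, (c k - c k * c k) ^ 2 := by
    rw [Finset.mul_sum]
    exact Finset.sum_le_sum fun k _ => h1 k
  have hd : ∑ k, e k = ((Finset.univ.filter fun k => 1 / 2 < c k).card : ℝ) := by
    simp [he]
  refine ⟨spectralKernel b e, (Finset.univ.filter fun k => 1 / 2 < c k).card,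
    isProjKernel_spectralKernel b e hee, ?_, ?_, ?_⟩
  · rw [spectralKernel_trace, hd]
  · simp only [spectralKernel_sub]
    rw [spectralKernel_sum_sq, sum_sub_contr11_sq]
    exact h2
  · rw [sum_sub_contr11_sq, spectralKernel_sum_sq, ← hd]
    -- Since `e² = e`, the gap is a sum of differences of squares, ready for Cauchy-Schwarz; 40 is
    -- the product of the constants 4 and 10 below.
    have h3 : (∑ k, c k ^ 2) - ∑ k, e k = ∑ k, (c k - e k) * (c k + e k) := by
      rw [← Finset.sum_sub_distrib]
      exact Finset.sum_congr rfl fun k _ => by linarith [hee k]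
    rw [h3]
    refine (Finset.sum_mul_sq_le_sq_mul_sq Finset.univ _ _).trans ?_
    have h4 : ∑ k, (c k + e k) ^ 2 ≤ 10 * ∑ k, c k ^ 2 := by
      rw [Finset.mul_sum]
      refine Finset.sum_le_sum fun k _ => ?_
      simp only [he]
      split_ifs with h
      · nlinarith
      · nlinarith [sq_nonneg (c k)]
    have h5 : ∑ k, (c k - e k) ^ 2 ≤ 4 * ∑ k, (c k - c k * c k) ^ 2 := by
      refine le_trans (le_of_eq (Finset.sum_congr rfl fun k _ => ?_)) h2
      ring
    calc _ ≤ (4 * ∑ k, (c k - c k * c k) ^ 2) * (10 * ∑ k, c k ^ 2) := by gcongr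
      _ = _ := by ring

theorem quadForm_eq_kernelForm {n : ℕ} {Ω : Type*} {f : Fin n → Fin n → ℝ}
    (hf0 : ∀ i, f i i = 0) (X : Fin n → Ω → ℝ) :
    quadForm f X = fun ω => kernelForm f fun i => X i ω := by
  ext ω
  have h1 : kernelForm f (fun i => X i ω) = ∑ i, ∑ j, f i j * X i ω * X j ω := by
    unfold kernelForm kernelCoord
    refine Finset.sum_congr rfl fun i _ => ?_
    rw [Finset.mul_sum]
    exact Finset.sum_congr rfl fun j _ => by ring
  rw [h1, sum_sum_eq_offDiag_add_diag, quadForm]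
  simp [hf0]

/-- Distance of a quadratic form to a centered Gamma law. -/
theorem kappa_quadForm_sq_le {ν : ℝ} (hν : 0 < ν) : ∃ c : ℝ, 0 < c ∧
    ∀ (n : ℕ) (Ω : Type*) [MeasurableSpace Ω] (P : Measure Ω) [IsProbabilityMeasure P]
      (X : Fin n → Ω → ℝ) (f : Fin n → Fin n → ℝ) (M : ℝ),
      iIndepFun X P → (∀ i, MemLp (X i) 4 P) → (∀ i, ∫ ω, X i ω ∂P = 0) →
      (∀ i, variance (X i) P = 1) → (∀ i, ∫ ω, X i ω ^ 4 ∂P ≤ M) →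
      (∀ i j, f i j = f j i) → (∀ i, f i i = 0) → ∑ i, ∑ j, f i j ^ 2 = ν →
      kappa testClass (P.map (quadForm f X)) (centeredGamma (ν / 2) (1 / 2)) ^ 2 ≤
        ENNReal.ofReal (c * M ^ 2 * ∑ i, ∑ j, (f i j - contr11 f f i j) ^ 2) := by
  obtain ⟨δ, hδ, hδm⟩ := exists_pos_le_abs_sub_natCast ν
  set L := ∫ y, |y| ∂centeredGamma (ν / 2) (1 / 2) with hL
  have hL0 : 0 ≤ L := integral_nonneg fun y => abs_nonneg y
  have hγ := isProbabilityMeasure_gammaMeasure (half_pos hν) (one_half_pos (α := ℝ))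
  have hγ' : IsProbabilityMeasure (centeredGamma (ν / 2) (1 / 2)) :=
    Measure.isProbabilityMeasure_map (by fun_prop)
  -- The first summand serves the case where the rank equals `ν`, the second the case where it does
  -- not.
  refine ⟨4 * (3 + 648 * √ν) ^ 2 + (√(6 * ν) + L) ^ 2 * (40 * ν / δ ^ 2), by positivity, ?_⟩
  intro n Ω _ P _ X f M hX h4 h1 hvar hM hf hf0 hsum
  have hm : ∀ i, AEMeasurable (X i) P := fun i => (h4 i).aestronglyMeasurable.aemeasurable
  have hPm : ∀ i, IsProbabilityMeasure (P.map (X i)) := fun i =>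
    Measure.isProbabilityMeasure_map (hm i)
  have hμ : ∀ i, HasNormalizedMoments (P.map (X i)) M := fun i =>
    hasNormalizedMoments_map (h4 i) (h1 i)
      (by rw [← hvar i, variance_of_integral_eq_zero (hm i) (h1 i)]) (hM i)
  have hM1 : 1 ≤ M := by
    rcases Nat.eq_zero_or_pos n with rfl | hn
    · simp at hsum; exact absurd hsum hν.ne
    · exact (hμ ⟨0, hn⟩).one_le
  obtain ⟨p, d, hp, hpd, hE, hgap⟩ := exists_isProjKernel_near hf
  set S := ∑ i, ∑ j, (f i j - contr11 f f i j) ^ 2 with hS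
  have hS0 : 0 ≤ S := Finset.sum_nonneg fun i _ => Finset.sum_nonneg fun j _ => sq_nonneg _
  rw [hsum] at hgap
  rw [quadForm_eq_kernelForm hf0]
  have hle : ∀ K : ℝ, (∀ φ ∈ testClass, |∫ x, φ (kernelForm f x)
      ∂(Measure.pi fun i => P.map (X i)) - ∫ y, φ y ∂centeredGamma (ν / 2) (1 / 2)| ≤ K) →
      0 ≤ K → K ^ 2 ≤ (4 * (3 + 648 * √ν) ^ 2 + (√(6 * ν) + L) ^ 2 * (40 * ν / δ ^ 2)) *
        M ^ 2 * S → kappa testClass (P.map fun ω => kernelForm f fun i => X i ω)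
          (centeredGamma (ν / 2) (1 / 2)) ^ 2 ≤ ENNReal.ofReal ((4 * (3 + 648 * √ν) ^ 2 +
            (√(6 * ν) + L) ^ 2 * (40 * ν / δ ^ 2)) * M ^ 2 * S) := by
    intro K hK hK0 hK2
    have hk : kappa testClass (P.map fun ω => kernelForm f fun i => X i ω)
        (centeredGamma (ν / 2) (1 / 2)) ≤ ENNReal.ofReal K := by
      refine kappa_le_of_forall fun φ hφ => ?_
      rw [integral_map_eq_integral_pi hX hm measurable_kernelForm hφ.1.continuous]
      exact hK φ hφ
    calc _ ≤ ENNReal.ofReal K ^ 2 := by gcongr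
      _ = ENNReal.ofReal (K ^ 2) := (ENNReal.ofReal_pow hK0 2).symm
      _ ≤ _ := ENNReal.ofReal_le_ofReal hK2
  by_cases hdν : (d : ℝ) = ν
  · rw [hdν] at hpd
    refine hle ((3 + 648 * √ν) * M * √(4 * S)) (fun φ hφ => ?_) (by positivity) ?_
    · have h2 := abs_integral_kernelForm_sub_centered_gaussian_le hM1 hμ hp hf hf0 hφ
      have h3 := integral_centeredGamma_eq hp (by rw [hpd]; exact hν) one_pos hφ.1.continuous
      simp only [hpd, mul_one, one_mul] at h2 h3
      rw [h3]
      refine h2.trans ?_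
      gcongr
    · rw [mul_pow, mul_pow, Real.sq_sqrt (by positivity)]
      have : 0 ≤ (√(6 * ν) + L) ^ 2 * (40 * ν / δ ^ 2) * M ^ 2 * S := by positivity
      nlinarith
  -- When the rank misses `ν`, the defect `S` is bounded below, so any bound independent of `S` is
  -- good enough: both expectations are compared with `φ 0` through first absolute moments.
  · have hδ2 : δ ^ 2 ≤ 40 * ν * S := by
      refine le_trans ?_ hgap
      rw [← sq_abs (ν - d)]
      gcongr
      exact hδm d hdν
    have hone : 1 ≤ 40 * ν / δ ^ 2 * S := by
      rw [div_mul_eq_mul_div, le_div_iff₀ (by positivity), one_mul]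
      exact hδ2
    refine hle ((√(6 * ν) + L) * M) (fun φ hφ => ?_) (by positivity) ?_
    · have hi := integrable_id_centeredGamma (half_pos hν) (one_half_pos (α := ℝ))
      obtain ⟨hF, hFle⟩ := integral_centered_form_sq_le hμ hf
      simp only [hf0, Finset.sum_const_zero, sub_zero, hsum] at hF hFle
      have key : ∀ {Ω' : Type} [MeasurableSpace Ω'] {Q : Measure Ω'} [IsProbabilityMeasure Q]
          {Y : Ω' → ℝ}, Integrable Y Q → |∫ ω, φ (Y ω) ∂Q - φ 0| ≤ ∫ ω, |Y ω| ∂Q := by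
        intro Ω' _ Q _ Y hY
        have h5 : ∫ ω, φ (Y ω) ∂Q - φ 0 = ∫ ω, (φ (Y ω) - φ 0) ∂Q := by
          rw [integral_sub (integrable_comp_of_mem_testClass hφ hY) (integrable_const _)]
          simp
        rw [h5, ← Real.norm_eq_abs]
        refine norm_integral_le_of_norm_le hY.abs (Filter.Eventually.of_forall fun ω => ?_)
        simpa using lipschitz_of_mem_testClass hφ 0 (Y ω)
      have k1 := key (hF.integrable one_le_two)
      have k2 := key hi
      have k3 : ∫ x, |kernelForm f x| ∂(Measure.pi fun i => P.map (X i)) ≤ √(6 * ν) * M := by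
        refine (integral_abs_le_sqrt hF).trans ((Real.sqrt_le_sqrt hFle).trans ?_)
        refine Real.sqrt_le_iff.2 ⟨by positivity, ?_⟩
        rw [mul_pow, Real.sq_sqrt (by positivity)]
        nlinarith [mul_nonneg hν.le (by nlinarith : 0 ≤ 6 * M ^ 2 - (4 + 2 * M))]
      rw [abs_le] at k1 k2 ⊢
      constructor <;> nlinarith [k1.1, k1.2, k2.1, k2.2]
    · have h6 : 0 ≤ 4 * (3 + 648 * √ν) ^ 2 * M ^ 2 * S := by positivity
      have h7 := mul_le_mul_of_nonneg_left hone
        (by positivity : 0 ≤ (√(6 * ν) + L) ^ 2 * M ^ 2)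
      rw [mul_pow]
      nlinarith

/-! ### The U-statistic and the final assembly. -/

theorem uStat_eq_kernelForm {n : ℕ} {Ω : Type*} {σ : ℝ} (hσ : σ ≠ 0) (X : Fin n → Ω → ℝ) :
    uStat X = fun ω => σ ^ 2 * kernelForm (fun i j => if i = j then 0 else 1 / ((n : ℝ) - 1))
      fun i => σ⁻¹ * X i ω := by
  ext ω
  have h1 : σ ^ 2 * kernelForm (fun i j => if i = j then 0 else 1 / ((n : ℝ) - 1))
      (fun i => σ⁻¹ * X i ω) = 1 / ((n : ℝ) - 1) * ∑ i, ∑ j,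
        if i = j then 0 else X i ω * X j ω := by
    unfold kernelForm kernelCoord
    simp only [Finset.mul_sum]
    refine Finset.sum_congr rfl fun i _ => Finset.sum_congr rfl fun j _ => ?_
    split_ifs
    · simp
    · field_simp
  have h2 : ∑ i, ∑ j ∈ Finset.Ioi i, X i ω * X j ω =
      ∑ i, ∑ j, if i < j then X i ω * X j ω else 0 := by
    refine Finset.sum_congr rfl fun i _ => ?_
    rw [← Finset.sum_filter]
    exact Finset.sum_congr (by ext; simp) fun _ _ => rfl
  have h3 : ∑ i, ∑ j, (if i < j then X i ω * X j ω else 0) =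
      ∑ i, ∑ j, if j < i then X i ω * X j ω else 0 := by
    rw [Finset.sum_comm]
    refine Finset.sum_congr rfl fun i _ => Finset.sum_congr rfl fun j _ => ?_
    rw [mul_comm]
  have h4 : ∑ i, ∑ j, (if i = j then 0 else X i ω * X j ω) =
      2 * ∑ i, ∑ j, if i < j then X i ω * X j ω else 0 := by
    rw [two_mul]
    conv_rhs => enter [2]; rw [h3]
    simp only [← Finset.sum_add_distrib]
    refine Finset.sum_congr rfl fun i _ => Finset.sum_congr rfl fun j _ => ?_
    rcases lt_trichotomy i j with h | h | h
    · simp [h, h.ne, h.not_gt]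
    · simp [h]
    · simp [h, h.ne', h.not_gt]
  rw [h1, h4, uStat, h2]
  ring

/-- Distance of a degenerate U-statistic of order two to a centered Gamma law. -/
theorem kappa_uStat_le {σ : ℝ} (hσ : 0 < σ) : ∃ c : ℝ, 0 < c ∧
    ∀ (n : ℕ) (hn : 2 ≤ n) (Ω : Type*) [MeasurableSpace Ω] (P : Measure Ω)
      [IsProbabilityMeasure P] (X : Fin n → Ω → ℝ) (i₀ : Fin n), iIndepFun X P →
      (∀ i j, IdentDistrib (X i) (X j) P P) → (∀ i, MemLp (X i) 4 P) →
      (∀ i, ∫ ω, X i ω ∂P = 0) → (∀ i, ∫ ω, X i ω ^ 2 ∂P = σ ^ 2) →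
      kappa testClass (P.map (uStat X)) (centeredGamma (1 / 2) (1 / (2 * σ ^ 2))) ≤
        ENNReal.ofReal (c * (σ ^ 2 / √(n : ℝ)) * ∫ ω, X i₀ ω ^ 4 ∂P) := by
  -- Dominates both `a` and `a²` for the scaling `a = σ²` of the test functions.
  set K := σ ^ 2 + σ ^ 4 with hK
  have hK0 : 0 < K := by positivity
  -- Here 651 = 3 + 648 at trace 1. Normalizing the fourth moment contributes `σ⁻⁴`, and the other
  -- `σ⁻²` offsets the `σ²` in the target bound.
  refine ⟨K * (651 * √2) / σ ^ 6, by positivity, ?_⟩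
  intro n hn Ω _ P _ X i₀ hX hid h4 h1 h2
  have hn1 : (1 : ℝ) < n := by exact_mod_cast hn
  set m4 := ∫ ω, X i₀ ω ^ 4 ∂P with hm4
  set x : Fin n → Ω → ℝ := fun i ω => σ⁻¹ * X i ω with hx
  have hxi : iIndepFun x P := hX.comp (fun _ a => σ⁻¹ * a) fun _ => by fun_prop
  have hx4 : ∀ i, MemLp (x i) 4 P := fun i => (h4 i).const_mul _
  have hm : ∀ i, AEMeasurable (x i) P := fun i => (hx4 i).aestronglyMeasurable.aemeasurable
  have hPm : ∀ i, IsProbabilityMeasure (P.map (x i)) := fun i =>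
    Measure.isProbabilityMeasure_map (hm i)
  have hμ : ∀ i, HasNormalizedMoments (P.map (x i)) (m4 / σ ^ 4) := fun i => by
    refine hasNormalizedMoments_map (hx4 i) ?_ ?_ ?_
    · simp only [hx, integral_const_mul, h1, mul_zero]
    · simp only [hx, mul_pow, integral_const_mul, h2]
      field_simp
    · simp only [hx, mul_pow, integral_const_mul]
      have : ∫ ω, X i ω ^ 4 ∂P = m4 :=
        ((hid i i₀).comp (u := fun a => a ^ 4) (by fun_prop)).integral_eq
      rw [this, inv_pow, div_eq_inv_mul]
  have hM1 := (hμ i₀).one_le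
  -- The projection onto constant vectors has rank one for every `n`, so no rounding is needed; its
  -- squared distance to `f` is exactly `1 / (n - 1)`.
  set p : Fin n → Fin n → ℝ := fun _ _ => 1 / (n : ℝ) with hpdef
  have hp : IsProjKernel p := ⟨fun _ _ => rfl, fun _ _ => by
    simp only [hpdef, Finset.sum_const, Finset.card_univ, Fintype.card_fin, nsmul_eq_mul]
    field_simp⟩
  have htr : ∑ i, p i i = 1 := by
    simp only [hpdef, Finset.sum_const, Finset.card_univ, Fintype.card_fin, nsmul_eq_mul]
    field_simp
  set f : Fin n → Fin n → ℝ := fun i j => if i = j then 0 else 1 / ((n : ℝ) - 1) with hfdef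
  have hE : ∑ i, ∑ j, (p i j - f i j) ^ 2 ≤ 2 / n := by
    have hn0 : (n : ℝ) - 1 ≠ 0 := by linarith
    have e1 : ∀ i j, (p i j - f i j) ^ 2 = (1 / (n : ℝ) - 1 / ((n : ℝ) - 1)) ^ 2 +
        if i = j then (1 / (n : ℝ)) ^ 2 - (1 / (n : ℝ) - 1 / ((n : ℝ) - 1)) ^ 2 else 0 :=
      fun i j => by
        simp only [hpdef, hfdef]
        split_ifs <;> ring
    simp only [e1, Finset.sum_add_distrib, Finset.sum_const, Finset.card_univ, Fintype.card_fin,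
      nsmul_eq_mul, Finset.sum_ite_eq, Finset.mem_univ, if_true]
    have e2 : (n : ℝ) * (n * (1 / (n : ℝ) - 1 / ((n : ℝ) - 1)) ^ 2) +
        n * ((1 / (n : ℝ)) ^ 2 - (1 / (n : ℝ) - 1 / ((n : ℝ) - 1)) ^ 2) = 1 / ((n : ℝ) - 1) := by
      field_simp
      ring
    rw [e2, div_le_div_iff₀ (by linarith) (by linarith)]
    have : (2 : ℝ) ≤ n := by exact_mod_cast hn
    linarith
  refine kappa_le_of_forall fun φ hφ => ?_
  have hψ := testClass_comp_affine hφ (a := σ ^ 2) (b := 0) hK0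
    (by rw [abs_of_nonneg (sq_nonneg σ), hK]; nlinarith [sq_nonneg (σ ^ 2)])
    (by rw [hK]; nlinarith [sq_nonneg σ])
  have h5 := abs_integral_kernelForm_sub_centered_gaussian_le hM1 hμ hp (f := f)
    (fun i j => by simp only [hfdef, eq_comm]) (fun i => by simp [hfdef]) hψ
  have h6 := integral_centeredGamma_eq hp (by rw [htr]; exact one_pos) (a := σ ^ 2)
    (by positivity) hφ.1.continuous
  have h7 : ∫ y, φ y ∂P.map (uStat X) = ∫ z, φ (σ ^ 2 * kernelForm f z)
      ∂(Measure.pi fun i => P.map (x i)) := by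
    rw [uStat_eq_kernelForm hσ.ne']
    exact integral_map_eq_integral_pi hxi hm (G := fun z => σ ^ 2 * kernelForm f z)
      (measurable_kernelForm.const_mul _) hφ.1.continuous
  simp only [htr, add_zero, integral_div, ← sub_div] at h5 h6
  rw [h6, h7]
  rw [abs_div, abs_of_pos hK0, div_le_iff₀ hK0] at h5
  refine h5.trans ?_
  have h8 : √(∑ i, ∑ j, (p i j - f i j) ^ 2) ≤ √2 / √(n : ℝ) := by
    rw [← Real.sqrt_div (by norm_num)]
    exact Real.sqrt_le_sqrt hE
  rw [Real.sqrt_one]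
  have hm40 : 0 ≤ m4 / σ ^ 4 := by linarith
  calc (3 + 648 * 1) * (m4 / σ ^ 4) * √(∑ i, ∑ j, (p i j - f i j) ^ 2) * K
      ≤ (3 + 648 * 1) * (m4 / σ ^ 4) * (√2 / √(n : ℝ)) * K := by gcongr
    _ = K * (651 * √2) / σ ^ 6 * (σ ^ 2 / √(n : ℝ)) * m4 := by
        field_simp
        ring

theorem mainTheorem11 :
    (∀ ν : ℝ, 0 < ν → ∃ c : ℝ, 0 < c ∧
      ∀ (n : ℕ) (Ω : Type*) [MeasurableSpace Ω] (P : Measure Ω) [IsProbabilityMeasure P]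
        (X : Fin n → Ω → ℝ) (f : Fin n → Fin n → ℝ),
        iIndepFun X P →
        (∀ i, MemLp (X i) 4 P) →
        (∀ i, ∫ ω, X i ω ∂P = 0) →
        (∀ i, variance (X i) P = 1) →
        (∀ i j, f i j = f j i) →
        (∀ i, f i i = 0) →
        ∑ i, ∑ j, f i j ^ 2 = ν →
        kappa testClass (P.map (quadForm f X)) (centeredGamma (ν / 2) (1 / 2)) ^ 2 ≤
          ENNReal.ofReal (c * (⨆ i, ∫ ω, X i ω ^ 4 ∂P) ^ 2 *
            ((∑ i, ∑ j, f i j ^ 4) + (∑ i, contr21 f f i ^ 2) +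
              ∑ i, ∑ j, (f i j - contr11 f f i j) ^ 2))) ∧
    (∀ σ : ℝ, 0 < σ → ∃ c : ℝ, 0 < c ∧
      ∀ (n : ℕ) (hn : 2 ≤ n) (Ω : Type*) [MeasurableSpace Ω] (P : Measure Ω)
        [IsProbabilityMeasure P] (X : Fin n → Ω → ℝ),
        iIndepFun X P →
        (∀ i j, IdentDistrib (X i) (X j) P P) →
        (∀ i, MemLp (X i) 4 P) →
        (∀ i, ∫ ω, X i ω ∂P = 0) →
        (∀ i, ∫ ω, X i ω ^ 2 ∂P = σ ^ 2) →
        kappa testClass (P.map (uStat X)) (centeredGamma (1 / 2) (1 / (2 * σ ^ 2))) ≤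
          ENNReal.ofReal (c * (σ ^ 2 / √(n : ℝ)) *
            ∫ ω, X ⟨0, by omega⟩ ω ^ 4 ∂P)) := by
  refine ⟨fun ν hν => ?_, fun σ hσ => ?_⟩
  swap
  · obtain ⟨c, hc, h⟩ := kappa_uStat_le hσ
    exact ⟨c, hc, fun n hn Ω _ P _ X => h n hn Ω P X _⟩
  obtain ⟨c, hc, h⟩ := kappa_quadForm_sq_le hν
  refine ⟨c, hc, fun n Ω _ P _ X f hX h4 h1 hvar hf hf0 hsum => ?_⟩
  refine (h n Ω P X f (⨆ i, ∫ ω, X i ω ^ 4 ∂P) hX h4 h1 hvar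
    (fun i => le_ciSup (f := fun i => ∫ ω, X i ω ^ 4 ∂P) (Set.finite_range _).bddAbove i)
    hf hf0 hsum).trans (ENNReal.ofReal_le_ofReal ?_)
  -- The bound already holds with the last sum alone; the other two are nonnegative.
  refine mul_le_mul_of_nonneg_left ?_ (by positivity)
  have e1 : 0 ≤ ∑ i, ∑ j, f i j ^ 4 :=
    Finset.sum_nonneg fun i _ => Finset.sum_nonneg fun j _ => by positivity
  have e2 : 0 ≤ ∑ i, contr21 f f i ^ 2 := Finset.sum_nonneg fun i _ => sq_nonneg _
  linarith
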